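/- For a discrete group $G$ and a family $\mathcal F$ of subgroups of $G$, a model for the classifying space $E_{\mathcal F}G$ is a $G$-CW-complex $X$ all of whose isotropy groups belong to $\mathcal F$ and whose fixed point set $X^H$ is contractible for every $H\in\mathcal F$. Write $\underline{E}G$ for the family of finite subgroups, $EG$ for the family consisting of the trivial subgroup, $E_KG$ for the family generated by a subgroup $K\le G$ (all subgroups of conjugates of $K$), and $E_{FBC}G$ for the family of all subgroups that are finite or isomorphic to $F'\rtimes\mathbb Z$ with $F'$ a finite group. Theorem. Let $V$ be a non-orientable virtually cyclic group, with short exact sequence $1\to F\to V\xrightarrow{p_V}D_\infty\to 1$ in which $F$ is finite, let $1\to\mathbb Z\to D_\infty\xrightarrow{p_D}\mathbb Z/2\to 1$ be a short exact sequence, and put $P_V=p_D\circ p_V$. Choose models $E_FV$, $\underline{E}V$ and $E\mathbb Z/2$, and let $P_V^*E\mathbb Z/2$ be $E\mathbb Z/2$ with $V$ acting through $P_V$. Let $i\colon E_FV\to\underline{E}V$ be an inclusion of $V$-CW-complexes, let $f\colon E_FV\to P_V^*E\mathbb Z/2$ be a continuous $V$-map, and let $X$ be the $V$-pushout $$\begin{array}{ccc}E_FV&\xrightarrow{\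 i\ }&\underline{E}V\\ {\scriptstyle f}\downarrow&&\downarrow\\ P_V^*E\mathbb Z/2&\longrightarrow&X.\end{array}$$ If $f$ is cellular, then $X$ is a $V$-CW-complex and a model for $E_{FBC}V$. More generally, for any such $f$, if $X$ admits the structure of a $V$-CW-complex, then $X$ is a model for $E_{FBC}V$. -/

import Mathlib

universe u v

/-! ### Equivariant CW-complexes for a discrete group -/

/-- The closed unit disk of dimension `n`. -/
abbrev UnitDisk (n : ℕ) : Type :=
  Metric.closedBall (0 : EuclideanSpace ℝ (Fin n)) 1

/-- A collection of equivariant cells `G/H × Dⁿ → X` in a `G`-set `X`: for every dimension `n` an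
index type of equivariant cells, and for each of them a subgroup `H` and a characteristic map.
(The indices of the cells of a `G`-CW-complex inject into its points, so that nothing is lost by
taking them in the universe of `X`.) -/
structure EquivariantCells (G : Type v) (X : Type u) [Group G] where
  cell : ℕ → Type u
  isotropy : (n : ℕ) → cell n → Subgroup G
  char : (n : ℕ) → (e : cell n) → G ⧸ isotropy n e → UnitDisk n → X

/-- `s.skeleton n` is the union of the closed cells of dimension `< n`, that is, the
`(n-1)`-skeleton; `s.skeleton 0` is empty. -/
def EquivariantCells.skeleton {G : Type v} {X : Type u} [Group G] (s : EquivariantCells G X)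
    (n : ℕ) : Set X :=
  {x | ∃ m, m < n ∧ ∃ (e : s.cell m) (c : G ⧸ s.isotropy m e) (y : UnitDisk m),
    s.char m e c y = x}

/-- The open cell `gH × (interior of Dⁿ)` as a subset of `X`. -/
def EquivariantCells.openCell {G : Type v} {X : Type u} [Group G] (s : EquivariantCells G X)
    (n : ℕ) (e : s.cell n) (c : G ⧸ s.isotropy n e) : Set X :=
  s.char n e c '' {y : UnitDisk n | ‖(y : EuclideanSpace ℝ (Fin n))‖ < 1}

/-- A `G`-CW-structure on a `G`-space `X`, for a discrete group `G`: the skeleta exhaust `X`, `X`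
carries the colimit topology, and for each `n` the square
```
  ∐ₑ G/Hₑ × Sⁿ⁻¹ ---> skeleton n
        |                  |
        v                  v
  ∐ₑ G/Hₑ × Dⁿ  ----> skeleton (n + 1)
```
is a pushout of `G`-spaces. The fields `sphere_mem`, `interior_notMem` and `interior_injective` say
that the map from the pushout to `skeleton (n + 1)` is well defined and bijective, and
`continuous_char` and `isClosed_of_cells` that it is a homeomorphism. (Applied to
`A = skeleton (n + 1)`, the latter shows inductively that all skeleta are closed, so that being
closed in a skeleton and being closed in `X` are the same.) -/
structure GCWStructure (G : Type v) (X : Type u) [Group G] [TopologicalSpace X] [MulAction G X]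
    extends EquivariantCells G X where
  continuous_char : ∀ n e c, Continuous (char n e c)
  smul_char : ∀ n e (g : G) (c : G ⧸ isotropy n e) y, char n e (g • c) y = g • char n e c y
  sphere_mem : ∀ n e c (y : UnitDisk n), ‖(y : EuclideanSpace ℝ (Fin n))‖ = 1 →
    char n e c y ∈ toEquivariantCells.skeleton n
  interior_notMem : ∀ n e c (y : UnitDisk n), ‖(y : EuclideanSpace ℝ (Fin n))‖ < 1 →
    char n e c y ∉ toEquivariantCells.skeleton n
  interior_injective : ∀ n (a b : Σ e : cell n, G ⧸ isotropy n e) (y z : UnitDisk n),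
    ‖(y : EuclideanSpace ℝ (Fin n))‖ < 1 → ‖(z : EuclideanSpace ℝ (Fin n))‖ < 1 →
    char n a.1 a.2 y = char n b.1 b.2 z → a = b ∧ y = z
  isClosed_of_cells : ∀ n (A : Set X), A ⊆ toEquivariantCells.skeleton (n + 1) →
    IsClosed (A ∩ toEquivariantCells.skeleton n) →
    (∀ e c, IsClosed (char n e c ⁻¹' A)) → IsClosed A
  exhaust : ∀ x, ∃ n, x ∈ toEquivariantCells.skeleton n
  isClosed_of_skeleta : ∀ A : Set X,
    (∀ n, IsClosed (A ∩ toEquivariantCells.skeleton n)) → IsClosed A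

/-- `i : A → B` is an inclusion of `G`-CW-complexes: it is a `G`-homeomorphism onto a closed
`G`-invariant subspace that is a union of open cells of `B`, and it identifies the skeleta of `A`
with those of this subcomplex. -/
structure IsGCWInclusion {G : Type v} {A B : Type u} [Group G]
    [TopologicalSpace A] [MulAction G A] [TopologicalSpace B] [MulAction G B]
    (sA : GCWStructure G A) (sB : GCWStructure G B) (i : A → B) : Prop where
  isClosedEmbedding : Topology.IsClosedEmbedding i
  map_smul : ∀ (g : G) a, i (g • a) = g • i a
  openCell_subset : ∀ n e c, (sB.openCell n e c ∩ Set.range i).Nonempty →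
    sB.openCell n e c ⊆ Set.range i
  preimage_skeleton : ∀ n, i ⁻¹' sB.skeleton n = sA.skeleton n

/-! ### Pushouts of `G`-spaces -/

/-- The square with sides `i : A → B`, `f : A → C`, `j : B → X`, `k : C → X` is a pushout in the
category of `G`-spaces and continuous `G`-maps (`G` discrete). -/
structure IsGPushout (G : Type v) {A B C X : Type u} [Group G]
    [TopologicalSpace B] [MulAction G B]
    [TopologicalSpace C] [MulAction G C] [TopologicalSpace X] [MulAction G X]
    (i : A → B) (f : A → C) (j : B → X) (k : C → X) : Prop where
  continuous_left : Continuous j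
  map_smul_left : ∀ (g : G) b, j (g • b) = g • j b
  continuous_right : Continuous k
  map_smul_right : ∀ (g : G) c, k (g • c) = g • k c
  comm : ∀ a, j (i a) = k (f a)
  existsUnique_desc : ∀ (Z : Type u) [TopologicalSpace Z] [MulAction G Z]
    [ContinuousConstSMul G Z] (b : B → Z) (c : C → Z),
    Continuous b → (∀ (g : G) x, b (g • x) = g • b x) →
    Continuous c → (∀ (g : G) x, c (g • x) = g • c x) →
    (∀ a, b (i a) = c (f a)) →
    ∃! h : X → Z, Continuous h ∧ (∀ (g : G) x, h (g • x) = g • h x) ∧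
      (∀ x, h (j x) = b x) ∧ (∀ x, h (k x) = c x)

/-! ### Classifying spaces for families of subgroups -/

/-- The `G`-space `X` is a model for the classifying space of `G` for the family `𝓕`: it is a
`G`-CW-complex, its isotropy groups lie in `𝓕`, and the fixed point sets of the members of `𝓕` are
contractible. -/
structure IsClassifyingSpace (G : Type v) (X : Type u) [Group G] [TopologicalSpace X]
    [MulAction G X] (𝓕 : Set (Subgroup G)) : Prop where
  isGCW : Nonempty (GCWStructure G X)
  stabilizer_mem : ∀ x : X, MulAction.stabilizer G x ∈ 𝓕
  contractible : ∀ H ∈ 𝓕, ContractibleSpace (MulAction.fixedPoints H X)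

/-- The family consisting of the trivial subgroup. -/
def trivialFamily (G : Type v) [Group G] : Set (Subgroup G) := {⊥}

/-- The family of finite subgroups. -/
def finiteFamily (G : Type v) [Group G] : Set (Subgroup G) := {H | Finite H}

/-- The family generated by a subgroup `K`: all subgroups of conjugates of `K`. -/
def familyGeneratedBy {G : Type v} [Group G] (K : Subgroup G) : Set (Subgroup G) :=
  {H | ∃ g : G, H ≤ K.map (MulAut.conj g).toMonoidHom}

/-- The family of finite-by-cyclic subgroups: those that are finite or isomorphic to `F ⋊ ℤ` for
some finite group `F`. -/
def finiteByCyclicFamily (G : Type v) [Group G] : Set (Subgroup G) :=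
  {H | Finite H ∨ ∃ (F : Type v) (_ : Group F) (_ : Finite F)
    (φ : Multiplicative ℤ →* MulAut F), Nonempty (H ≃* F ⋊[φ] Multiplicative ℤ)}

/-! The pushout glues `B` to `C` along `A`, and this passes to fixed points: for every subgroup `H`,
the space `X^H` is `B^H` glued to `C^H` along `A^H` (`IsGluing.fixedPoints`). Let `K` be the kernel
of `P_V`. The action on `C` through ℤ/2 is free, so `C^H` is all of the contractible space `C` if `H
≤ K`, and empty otherwise. For `H` in the family there are three cases. If `H ≤ K` is infinite, then
`B^H` is empty and `X^H` is a copy of `C`. If `H` is not contained in `K`, then `H` is finite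
(`le_ker_of_mulEquiv_semidirectProduct`): in an infinite finite-by-cyclic group the commutator of
any element with an infinite-order generator `τ` of the cyclic factor is torsion, whereas over `D_∞`
the commutator of a reflection with a nontrivial rotation has infinite order. Hence `X^H` is a copy
of the contractible space `B^H`. If `H ≤ K` is finite, then `H ≤ F` because `K/F` is infinite cyclic
(`finite_subgroup_le_ker`), and `A^H`, `B^H`, `C^H` are all contractible. Since `A^H → B^H` is a
relative cell complex, it has the homotopy extension property (`hasHEP_fixedPointsMap`), and
`IsGluing.contractibleSpace` applies. Points of `X` coming from `C` have stabilizer `K`, which is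
finite-by-cyclic because an extension of ℤ splits; all others have finite stabilizer. Cellularity of
`f` enters only through `IsGluing.gcwStructure`, which puts a cell structure on `X`. -/

section

open unitInterval Set Topology

/-! ### The homotopy extension property -/

/-- The homotopy extension property of a map `i : A → B`, for homotopies in spaces of the same
universe. Homotopies are written as maps into path spaces. -/
def HasHEP {A B : Type u} [TopologicalSpace A] [TopologicalSpace B] (i : A → B) : Prop :=
  ∀ (Y : Type u) [TopologicalSpace Y] (b : B → Y) (h : A → C(I, Y)), Continuous b → Continuous h →
    (∀ a, h a 0 = b (i a)) →
    ∃ h' : B → C(I, Y), Continuous h' ∧ (∀ x, h' x 0 = b x) ∧ ∀ a, h' (i a) = h a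

theorem UnitDisk.norm_le {n : ℕ} (y : UnitDisk n) : ‖(y : EuclideanSpace ℝ (Fin n))‖ ≤ 1 :=
  mem_closedBall_zero_iff.1 y.2

/-- The pair `(Dⁿ, Sⁿ⁻¹)` has the homotopy extension property. -/
theorem UnitDisk.exists_homotopy_extension {n : ℕ} {Y : Type*} [TopologicalSpace Y]
    {b : UnitDisk n → Y} (hb : Continuous b) {w : UnitDisk n → C(I, Y)}
    (hw : ContinuousOn w {y | ‖(y : EuclideanSpace ℝ (Fin n))‖ = 1})
    (hwb : ∀ y : UnitDisk n, ‖(y : EuclideanSpace ℝ (Fin n))‖ = 1 → w y 0 = b y) :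
    ∃ h : UnitDisk n → C(I, Y), Continuous h ∧ (∀ y, h y 0 = b y) ∧
      ∀ y : UnitDisk n, ‖(y : EuclideanSpace ℝ (Fin n))‖ = 1 → h y = w y := by
  -- Project `Dⁿ × I` from the point of height 2 above the centre onto `Dⁿ × 0 ∪ Sⁿ⁻¹ × I`. The ray
  -- through `(y, t)` hits the bottom at scale `1 / (1 - t/2)` and the side at scale `1 / ‖y‖`; `1 /
  -- m` is the smaller scale, and `(ρ, τ)` is the point that is hit.
  let m : UnitDisk n × I → ℝ := fun p => max ‖(p.1 : EuclideanSpace ℝ (Fin n))‖ (1 - p.2 / 2)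
  have hmc : Continuous m := by fun_prop
  have hnorm := UnitDisk.norm_le (n := n)
  have hm0 : ∀ p, 0 < m p := fun p => lt_of_lt_of_le (by linarith [p.2.2.2]) (le_max_right _ _)
  have hm1 : ∀ p, m p ≤ 1 := fun p => max_le (hnorm _) (by linarith [p.2.2.1])
  have hmne : ∀ p, m p ≠ 0 := fun p => (hm0 p).ne'
  let ρ : UnitDisk n × I → UnitDisk n := fun p =>
    ⟨(m p)⁻¹ • (p.1 : EuclideanSpace ℝ (Fin n)), by
      rw [mem_closedBall_zero_iff, norm_smul, norm_inv, Real.norm_of_nonneg (hm0 p).le,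
        inv_mul_le_one₀ (hm0 p)]
      exact le_max_left _ _⟩
  have hρ : Continuous ρ := by
    refine Continuous.subtype_mk ?_ _
    exact (hmc.inv₀ hmne).smul (continuous_subtype_val.comp continuous_fst)
  let τ : UnitDisk n × I → I := fun p =>
    ⟨2 - (2 - p.2) / m p, by
      rw [sub_nonneg, div_le_iff₀ (hm0 p)]
      have : 1 - (p.2 : ℝ) / 2 ≤ m p := le_max_right _ _
      linarith, by
      have : 1 ≤ (2 - (p.2 : ℝ)) / m p := by
        rw [le_div_iff₀ (hm0 p)]
        linarith [hm1 p, p.2.2.2]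
      linarith⟩
  have hτ : Continuous τ := by
    refine Continuous.subtype_mk ?_ _
    exact continuous_const.sub ((continuous_const.sub
      (continuous_subtype_val.comp continuous_snd)).div hmc hmne)
  have hρ_sphere : ∀ p : UnitDisk n × I, 1 - (p.2 : ℝ) / 2 ≤ ‖(p.1 : EuclideanSpace ℝ (Fin n))‖ →
      ‖(ρ p : EuclideanSpace ℝ (Fin n))‖ = 1 := fun p hp => by
    have h1 : m p = ‖(p.1 : EuclideanSpace ℝ (Fin n))‖ := max_eq_left hp
    change ‖(m p)⁻¹ • (p.1 : EuclideanSpace ℝ (Fin n))‖ = 1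
    rw [norm_smul, norm_inv, Real.norm_of_nonneg (hm0 p).le, ← h1, inv_mul_cancel₀ (hmne p)]
  let k : UnitDisk n × I → Y := fun p =>
    if ‖(p.1 : EuclideanSpace ℝ (Fin n))‖ ≤ 1 - (p.2 : ℝ) / 2 then b (ρ p) else w (ρ p) (τ p)
  have hk : Continuous k := by
    refine continuous_if_le (by fun_prop) (by fun_prop) (hb.comp hρ).continuousOn ?_ ?_
    · have h1 : ContinuousOn (fun p => w (ρ p)) {p : UnitDisk n × I |
          1 - (p.2 : ℝ) / 2 ≤ ‖(p.1 : EuclideanSpace ℝ (Fin n))‖} :=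
        hw.comp hρ.continuousOn fun p hp => hρ_sphere p hp
      exact h1.eval hτ.continuousOn
    · intro p hp
      have h1 : m p = 1 - (p.2 : ℝ) / 2 := max_eq_right hp.le
      have h2 : τ p = 0 := by
        apply Subtype.ext
        change 2 - (2 - (p.2 : ℝ)) / m p = 0
        rw [sub_eq_zero, eq_div_iff (hmne p), h1]
        ring
      rw [h2, hwb _ (hρ_sphere p hp.ge)]
  refine ⟨fun y => ⟨fun t => k (y, t), by fun_prop⟩,
    ContinuousMap.continuous_of_continuous_uncurry _ hk, fun y => ?_, fun y hy => ?_⟩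
  · have h1 : m (y, 0) = 1 := by simpa [m] using hnorm y
    have h2 : ρ (y, 0) = y := by
      apply Subtype.ext
      change (m (y, 0))⁻¹ • (y : EuclideanSpace ℝ (Fin n)) = y
      rw [h1, inv_one, one_smul]
    have h3 : ‖(y : EuclideanSpace ℝ (Fin n))‖ ≤ 1 - ((0 : I) : ℝ) / 2 := by simpa using hnorm y
    change k (y, 0) = b y
    simp only [k, if_pos h3, h2]
  · ext t
    have h1 : m (y, t) = 1 := by
      simp only [m, hy]
      exact max_eq_left (by linarith [t.2.1])
    have h2 : ρ (y, t) = y := by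
      apply Subtype.ext
      change (m (y, t))⁻¹ • (y : EuclideanSpace ℝ (Fin n)) = y
      rw [h1, inv_one, one_smul]
    have h3 : τ (y, t) = t := by
      apply Subtype.ext
      change 2 - (2 - (t : ℝ)) / m (y, t) = t
      rw [h1]
      ring
    change k (y, t) = w y t
    simp only [k, h2, h3]
    split_ifs with h4
    · have : t = 0 := by
        apply Subtype.ext
        rw [hy] at h4
        change (t : ℝ) = 0
        linarith [t.2.1]
      rw [this, hwb y hy]
    · rfl

/-- A filtration of a space `T` by subsets `S n`, such that `S (n + 1)` arises from `S n` by
attaching the `n`-cells `χ n e`, and such that `T` is the colimit of the `S n`. -/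
structure IsRelativeCellComplex {T : Type u} [TopologicalSpace T] (S : ℕ → Set T) {ι : ℕ → Type v}
    (χ : ∀ n, ι n → UnitDisk n → T) : Prop where
  continuous_char : ∀ n e, Continuous (χ n e)
  succ_eq : ∀ n, S (n + 1) = S n ∪ ⋃ e, range (χ n e)
  sphere_mem : ∀ n e (y : UnitDisk n), ‖(y : EuclideanSpace ℝ (Fin n))‖ = 1 → χ n e y ∈ S n
  interior_notMem : ∀ n e (y : UnitDisk n), ‖(y : EuclideanSpace ℝ (Fin n))‖ < 1 → χ n e y ∉ S n
  interior_injective : ∀ n e e' (y z : UnitDisk n),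
    ‖(y : EuclideanSpace ℝ (Fin n))‖ < 1 → ‖(z : EuclideanSpace ℝ (Fin n))‖ < 1 →
    χ n e y = χ n e' z → e = e' ∧ y = z
  isClosed_of_cells : ∀ n (Z : Set T), Z ⊆ S (n + 1) → IsClosed (Z ∩ S n) →
    (∀ e, IsClosed (χ n e ⁻¹' Z)) → IsClosed Z
  exhaust : ∀ x, ∃ n, x ∈ S n
  isClosed_of_filtration : ∀ Z : Set T, (∀ n, IsClosed (Z ∩ S n)) → IsClosed Z

namespace IsRelativeCellComplex

variable {T : Type u} [TopologicalSpace T] {S : ℕ → Set T} {ι : ℕ → Type v}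
  {χ : ∀ n, ι n → UnitDisk n → T}

theorem subset_succ (hS : IsRelativeCellComplex S χ) (n : ℕ) : S n ⊆ S (n + 1) := by
  rw [hS.succ_eq]
  exact subset_union_left

/-- A homotopy on one stage of the filtration, given as a map that is continuous there, extends
to the next stage. -/
theorem exists_extension_succ (hS : IsRelativeCellComplex S χ) {Y : Type*} [TopologicalSpace Y]
    {b : T → Y} (hb : Continuous b) (n : ℕ) (q : T → C(I, Y)) (hq0 : ∀ x, q x 0 = b x)
    (hq : ∀ Z, IsClosed Z → IsClosed (S n ∩ q ⁻¹' Z)) :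
    ∃ q' : T → C(I, Y), ((∀ x, q' x 0 = b x) ∧
      ∀ Z, IsClosed Z → IsClosed (S (n + 1) ∩ q' ⁻¹' Z)) ∧ EqOn q' q (S n) := by
  classical
  have hcell : ∀ e : ι n, ∃ h : UnitDisk n → C(I, Y), Continuous h ∧
      (∀ y, h y 0 = b (χ n e y)) ∧
      ∀ y : UnitDisk n, ‖(y : EuclideanSpace ℝ (Fin n))‖ = 1 → h y = q (χ n e y) := by
    intro e
    refine UnitDisk.exists_homotopy_extension (hb.comp (hS.continuous_char n e)) ?_
      fun y _ => hq0 _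
    rw [continuousOn_iff_isClosed]
    intro Z hZ
    refine ⟨χ n e ⁻¹' (S n ∩ q ⁻¹' Z), (hq Z hZ).preimage (hS.continuous_char n e), ?_⟩
    ext y
    constructor
    · rintro ⟨h1, h2⟩
      exact ⟨⟨hS.sphere_mem n e y h2, h1⟩, h2⟩
    · rintro ⟨h1, h2⟩
      exact ⟨h1.2, h2⟩
  choose k hkc hk0 hk1 using hcell
  -- Outside `S (n + 1)` the old value is kept, so that the initial condition stays true on all of
  -- `T`.
  let q' : T → C(I, Y) := fun x =>
    if x ∈ S n then q x else if h : ∃ p : ι n × UnitDisk n, χ n p.1 p.2 = x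
      then k h.choose.1 h.choose.2 else q x
  have hEq : EqOn q' q (S n) := fun x hx => if_pos hx
  have hnorm := UnitDisk.norm_le (n := n)
  have hq'k : ∀ e y, q' (χ n e y) = k e y := by
    -- The chosen preimage is irrelevant: an interior point has only one, and on the sphere both
    -- sides equal `q`.
    intro e y
    rcases (hnorm y).lt_or_eq with hy | hy
    · have h1 := hS.interior_notMem n e y hy
      have h2 : ∃ p : ι n × UnitDisk n, χ n p.1 p.2 = χ n e y := ⟨(e, y), rfl⟩
      have h3 : q' (χ n e y) = k h2.choose.1 h2.choose.2 := by
        simp only [q']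
        rw [if_neg h1, dif_pos h2]
      have h4 := h2.choose_spec
      have h5 : ‖(h2.choose.2 : EuclideanSpace ℝ (Fin n))‖ < 1 := by
        refine (hnorm _).lt_of_ne fun h => h1 ?_
        rw [← h4]
        exact hS.sphere_mem _ _ _ h
      obtain ⟨h6, h7⟩ := hS.interior_injective _ _ _ _ _ h5 hy h4
      rw [h3, h6, h7]
    · rw [hk1 e y hy]
      exact hEq (hS.sphere_mem n e y hy)
  refine ⟨q', ⟨fun x => ?_, fun Z hZ => ?_⟩, hEq⟩
  · by_cases hx : x ∈ S n
    · rw [hEq hx, hq0]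
    · by_cases h : ∃ p : ι n × UnitDisk n, χ n p.1 p.2 = x
      · obtain ⟨p, rfl⟩ := h
        rw [hq'k, hk0]
      · simp only [q']
        rw [if_neg hx, dif_neg h, hq0]
  · refine hS.isClosed_of_cells n _ inter_subset_left ?_ fun e => ?_
    · convert hq Z hZ using 1
      ext x
      constructor
      · rintro ⟨⟨-, h1⟩, h2⟩
        refine ⟨h2, ?_⟩
        rwa [mem_preimage, hEq h2] at h1
      · rintro ⟨h1, h2⟩
        refine ⟨⟨hS.subset_succ n h1, ?_⟩, h1⟩
        rwa [mem_preimage, hEq h1]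
    · convert hZ.preimage (hkc e) using 1
      ext y
      rw [mem_preimage, mem_inter_iff, mem_preimage, hq'k, mem_preimage, and_iff_right]
      rw [hS.succ_eq]
      exact Or.inr (mem_iUnion.2 ⟨e, y, rfl⟩)

/-- Relative cell complexes have the homotopy extension property. -/
theorem hasHEP (hS : IsRelativeCellComplex S χ) {A : Type u} [TopologicalSpace A] {i : A → T}
    (hi : IsClosedEmbedding i) (hiS : S 0 = range i) : HasHEP i := by
  classical
  intro Y _ b h hb hh h0
  let Good (n : ℕ) (q : T → C(I, Y)) : Prop :=
    (∀ x, q x 0 = b x) ∧ ∀ Z, IsClosed Z → IsClosed (S n ∩ q ⁻¹' Z)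
  let q₀ : T → C(I, Y) := fun x => if hx : ∃ a, i a = x then h hx.choose else .const I (b x)
  have hq₀i : ∀ a, q₀ (i a) = h a := fun a => by
    have hx : ∃ a', i a' = i a := ⟨a, rfl⟩
    simp only [q₀]
    rw [dif_pos hx, hi.injective hx.choose_spec]
  have hq₀ : Good 0 q₀ := by
    refine ⟨fun x => ?_, fun Z hZ => ?_⟩
    · by_cases hx : ∃ a, i a = x
      · obtain ⟨a, rfl⟩ := hx
        rw [hq₀i, h0]
      · simp only [q₀]
        rw [dif_neg hx, ContinuousMap.const_apply]
    · convert hi.isClosedMap _ (hZ.preimage hh) using 1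
      ext x
      rw [hiS]
      constructor
      · rintro ⟨⟨a, rfl⟩, h1⟩
        rw [mem_preimage, hq₀i] at h1
        exact ⟨a, h1, rfl⟩
      · rintro ⟨a, h1, rfl⟩
        refine ⟨⟨a, rfl⟩, ?_⟩
        rwa [mem_preimage, hq₀i]
  have hstep : ∀ n (q : {q // Good n q}), ∃ q' : {q // Good (n + 1) q}, EqOn q'.1 q.1 (S n) :=
    fun n q => by
      obtain ⟨q', h1, h2⟩ := hS.exists_extension_succ hb n q.1 q.2.1 q.2.2
      exact ⟨⟨q', h1⟩, h2⟩
  choose next hnext using hstep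
  let Q : ∀ n, {q // Good n q} := fun n => Nat.rec ⟨q₀, hq₀⟩ (fun n q => next n q) n
  have hQ : ∀ n, EqOn (Q (n + 1)).1 (Q n).1 (S n) := fun n => hnext n (Q n)
  have hmono : Monotone S := monotone_nat_of_le_succ hS.subset_succ
  have hQle : ∀ m n, m ≤ n → EqOn (Q n).1 (Q m).1 (S m) := by
    intro m n hmn
    induction n, hmn using Nat.le_induction with
    | base => exact fun x _ => rfl
    | succ n hmn ih => exact fun x hx => (hQ n (hmono hmn hx)).trans (ih hx)
  choose N hN using hS.exhaust
  have hlim : ∀ n x, x ∈ S n → (Q (N x)).1 x = (Q n).1 x := by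
    intro n x hx
    rcases le_total (N x) n with hle | hle
    · exact (hQle _ _ hle (hN x)).symm
    · exact hQle _ _ hle hx
  -- On each stage the sequence of extensions is eventually constant, and this is its limit.
  refine ⟨fun x => (Q (N x)).1 x, ?_, fun x => (Q (N x)).2.1 x, fun a => ?_⟩
  · rw [continuous_iff_isClosed]
    intro Z hZ
    refine hS.isClosed_of_filtration _ fun n => ?_
    convert (Q n).2.2 Z hZ using 1
    ext x
    rw [inter_comm]
    refine and_congr_right fun hx => ?_
    rw [mem_preimage, mem_preimage, hlim n x hx]
  · change (Q (N (i a))).1 (i a) = h a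
    rw [hlim 0 (i a) (by rw [hiS]; exact ⟨a, rfl⟩)]
    exact hq₀i a

end IsRelativeCellComplex

/-! ### Gluing spaces along a closed subspace -/

/-- `X` is obtained by gluing `B` to `C` along `f : A → C`, where `A` is a subspace of `B` by means
of `i`. -/
structure IsGluing {A B C X : Type*} [TopologicalSpace B] [TopologicalSpace C]
    [TopologicalSpace X] (i : A → B) (f : A → C) (j : B → X) (k : C → X) : Prop where
  continuous_left : Continuous j
  continuous_right : Continuous k
  comm : ∀ a, j (i a) = k (f a)
  surj : ∀ x, (∃ b, j b = x) ∨ ∃ c, k c = x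
  injective_right : Function.Injective k
  left_eq_right : ∀ b c, j b = k c → ∃ a, i a = b ∧ f a = c
  left_eq_left : ∀ b b', j b = j b' → b = b' ∨ b ∈ range i
  isClosed_of_preimage : ∀ Z : Set X, IsClosed (j ⁻¹' Z) → IsClosed (k ⁻¹' Z) → IsClosed Z

namespace IsGluing

section

variable {A B C X : Type*} [TopologicalSpace B] [TopologicalSpace C]
  [TopologicalSpace X] {i : A → B} {f : A → C} {j : B → X} {k : C → X}

/-- Used with `W` a path space: homotopies on `X` are then glued as plain maps, and the quotient
topology never has to be compared with a product with `I`. -/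
theorem exists_desc (hX : IsGluing i f j k) {W : Type*} [TopologicalSpace W] {b : B → W}
    {c : C → W} (hb : Continuous b) (hc : Continuous c) (h : ∀ a, b (i a) = c (f a)) :
    ∃ d : X → W, Continuous d ∧ (∀ x, d (j x) = b x) ∧ ∀ x, d (k x) = c x := by
  classical
  let d : X → W := fun x => if hx : ∃ y, k y = x then c hx.choose
    else b ((hX.surj x).resolve_right hx).choose
  have hdk : ∀ y, d (k y) = c y := fun y => by
    have hx : ∃ y', k y' = k y := ⟨y, rfl⟩
    simp only [d]
    rw [dif_pos hx, hX.injective_right hx.choose_spec]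
  have hdj : ∀ y, d (j y) = b y := fun y => by
    by_cases hx : ∃ z, k z = j y
    · obtain ⟨z, hz⟩ := hx
      obtain ⟨a, rfl, rfl⟩ := hX.left_eq_right y z hz.symm
      rw [← hz, hdk, h]
    · simp only [d]
      rw [dif_neg hx]
      have h1 := ((hX.surj (j y)).resolve_right hx).choose_spec
      rcases hX.left_eq_left _ _ h1 with h2 | ⟨a, ha⟩
      · rw [h2]
      · refine (hx ⟨f a, ?_⟩).elim
        rw [← hX.comm, ha, h1]
  refine ⟨d, ?_, hdj, hdk⟩
  rw [continuous_iff_isClosed]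
  intro Z hZ
  refine hX.isClosed_of_preimage _ ?_ ?_
  · convert hZ.preimage hb using 1
    ext y
    rw [mem_preimage, mem_preimage, hdj, mem_preimage]
  · convert hZ.preimage hc using 1
    ext y
    rw [mem_preimage, mem_preimage, hdk, mem_preimage]

/-- The map `f` forces `A` to be empty as well, so nothing is identified and `j` is a homeomorphism.
-/
theorem contractibleSpace_of_isEmpty_right (hX : IsGluing i f j k) [IsEmpty C]
    [ContractibleSpace B] : ContractibleSpace X := by
  have hA : IsEmpty A := Function.isEmpty f
  have hq : IsHomeomorph j := by
    rw [isHomeomorph_iff_continuous_isClosedMap_bijective]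
    have hinj : Function.Injective j := fun b b' h => by
      rcases hX.left_eq_left b b' h with h | ⟨a, -⟩
      · exact h
      · exact isEmptyElim a
    refine ⟨hX.continuous_left, fun Z hZ => hX.isClosed_of_preimage _ ?_ ?_, hinj, fun x => ?_⟩
    · rwa [preimage_image_eq _ hinj]
    · rw [Subsingleton.elim (k ⁻¹' (j '' Z)) ∅]
      exact isClosed_empty
    · rcases hX.surj x with h | ⟨c, -⟩
      · exact h
      · exact isEmptyElim c
  exact (hq.homeomorph j).symm.contractibleSpace

theorem contractibleSpace_of_isEmpty_left (hX : IsGluing i f j k) [IsEmpty B]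
    [ContractibleSpace C] : ContractibleSpace X := by
  have hq : IsHomeomorph k := by
    rw [isHomeomorph_iff_continuous_isClosedMap_bijective]
    refine ⟨hX.continuous_right, fun Z hZ => hX.isClosed_of_preimage _ ?_ ?_,
      hX.injective_right, fun x => ?_⟩
    · rw [Subsingleton.elim (j ⁻¹' (k '' Z)) ∅]
      exact isClosed_empty
    · rwa [preimage_image_eq _ hX.injective_right]
    · rcases hX.surj x with ⟨b, -⟩ | h
      · exact isEmptyElim b
      · exact h
  exact (hq.homeomorph k).symm.contractibleSpace

end

theorem _root_.ContractibleSpace.exists_contraction (T : Type*) [TopologicalSpace T] [ContractibleSpace T] :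
    ∃ (x₀ : T) (h : T → C(I, T)), Continuous h ∧ (∀ x, h x 0 = x) ∧ ∀ x, h x 1 = x₀ := by
  obtain ⟨x₀, ⟨H⟩⟩ := id_nullhomotopic T
  refine ⟨x₀, fun x => ⟨fun t => H (t, x), by fun_prop⟩,
    ContinuousMap.continuous_of_continuous_uncurry _ ?_, fun x => ?_, fun x => ?_⟩
  · change Continuous fun p : T × I => H (p.2, p.1)
    fun_prop
  · simp
  · simp

theorem _root_.ContinuousMap.homotopic_of_pathFamily {T Y : Type*} [TopologicalSpace T] [TopologicalSpace Y]
    {h : T → C(I, Y)} (hh : Continuous h) (p q : C(T, Y)) (h0 : ∀ x, h x 0 = p x)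
    (h1 : ∀ x, h x 1 = q x) : p.Homotopic q :=
  ⟨{ toFun := fun z => h z.2 z.1
     continuous_toFun := (hh.comp continuous_snd).eval continuous_fst
     map_zero_left := h0
     map_one_left := h1 }⟩

/-- Gluing two contractible spaces along a contractible subspace with the homotopy extension
property gives a contractible space. -/
theorem contractibleSpace {A B C X : Type u} [TopologicalSpace A] [TopologicalSpace B]
    [TopologicalSpace C] [TopologicalSpace X] {i : A → B} {f : A → C} {j : B → X} {k : C → X}
    (hX : IsGluing i f j k) (hic : Continuous i) (hf : Continuous f) (hi : HasHEP i)
    [ContractibleSpace A] [ContractibleSpace B] [ContractibleSpace C] : ContractibleSpace X := by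
  obtain ⟨a₀, hA, hAc, hA0, hA1⟩ := ContractibleSpace.exists_contraction A
  obtain ⟨b₀, hB, hBc, hB0, hB1⟩ := ContractibleSpace.exists_contraction B
  obtain ⟨c₀, hC, hCc, hC0, hC1⟩ := ContractibleSpace.exists_contraction C
  -- the contraction of `C` extends to a homotopy from the identity to a map `g`
  obtain ⟨h₁, h₁c, h₁0, h₁i⟩ := hi X j
    (fun a => (⟨k, hX.continuous_right⟩ : C(C, X)).comp (hC (f a))) hX.continuous_left
    ((ContinuousMap.continuous_postcomp _).comp (hCc.comp hf))
    (fun a => by simp [hC0, hX.comm])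
  obtain ⟨G, hG, hGj, hGk⟩ := hX.exists_desc (b := h₁)
    (c := fun c => (⟨k, hX.continuous_right⟩ : C(C, X)).comp (hC c)) h₁c
    ((ContinuousMap.continuous_postcomp _).comp hCc) h₁i
  let g : C(X, X) := ⟨fun x => G x 1, hG.eval_const 1⟩
  -- The map `g`, homotopic to the identity, collapses `C` to a point; hence `g ∘ j` collapses `A`.
  have hgk : ∀ c, g (k c) = k c₀ := fun c => by simp [g, hGk, hC1]
  let gj : C(B, X) := g.comp ⟨j, hX.continuous_left⟩
  have hgj : ∀ b, gj b = g (j b) := fun b => rfl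
  have hgji : ∀ a, gj (i a) = k c₀ := fun a => by rw [hgj, hX.comm, hgk]
  -- the contraction of `A` extends to a homotopy `K` from the identity of `B`
  obtain ⟨K, hK, hK0, hKi⟩ := hi B id (fun a => (⟨i, hic⟩ : C(A, B)).comp (hA a)) continuous_id
    ((ContinuousMap.continuous_postcomp _).comp hAc) (fun a => by simp [hA0])
  -- Since `K` keeps `A` inside `A`, where `g ∘ j` is constant, this homotopy is stationary on `A`
  -- and descends to `X`.
  obtain ⟨P, hP, hPj, hPk⟩ := hX.exists_desc (b := fun b => gj.comp (K b))
    (c := fun _ => .const I (k c₀)) ((ContinuousMap.continuous_postcomp _).comp hK)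
    continuous_const (fun a => by ext t; simp [hKi, hgji])
  let φ : C(B, B) := ⟨fun b => K b 1, hK.eval_const 1⟩
  have hφi : ∀ a, φ (i a) = i a₀ := fun a => by simp [φ, hKi, hA1]
  -- As `φ` sends `A` to one point, all of `A` follows the same path under the contraction of `B`,
  -- and that path can be used on `C`.
  obtain ⟨Q, hQ, hQj, hQk⟩ := hX.exists_desc (b := fun b => gj.comp (hB (φ b)))
    (c := fun _ => gj.comp (hB (i a₀)))
    ((ContinuousMap.continuous_postcomp _).comp (hBc.comp φ.continuous))
    continuous_const (fun a => by rw [hφi])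
  let p : C(X, X) := ⟨fun x => P x 1, hP.eval_const 1⟩
  rw [contractible_iff_id_nullhomotopic]
  refine ⟨gj b₀, ?_⟩
  have e₁ : (ContinuousMap.id X).Homotopic g := by
    refine ContinuousMap.homotopic_of_pathFamily hG _ _ (fun x => ?_) fun x => rfl
    rcases hX.surj x with ⟨b, rfl⟩ | ⟨c, rfl⟩
    · simp [hGj, h₁0]
    · simp [hGk, hC0]
  have e₂ : g.Homotopic p := by
    refine ContinuousMap.homotopic_of_pathFamily hP _ _ (fun x => ?_) fun x => rfl
    rcases hX.surj x with ⟨b, rfl⟩ | ⟨c, rfl⟩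
    · simp [hPj, hK0, hgj]
    · simp [hPk, hgk]
  have e₃ : p.Homotopic (.const X (gj b₀)) := by
    refine ContinuousMap.homotopic_of_pathFamily hQ _ _ (fun x => ?_) fun x => ?_
    · rcases hX.surj x with ⟨b, rfl⟩ | ⟨c, rfl⟩
      · simp [hQj, hB0, p, hPj, φ]
      · simp [hQk, hB0, p, hPk, hgji]
    · rcases hX.surj x with ⟨b, rfl⟩ | ⟨c, rfl⟩
      · simp [hQj, hB1]
      · simp [hQk, hB1]
  exact (e₁.trans e₂).trans e₃

end IsGluing

/-! ### Equivariant CW-structures -/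

/-- The closed ball is the closure of the open ball. This passes from an open cell to the whole
cell. -/
theorem UnitDisk.eq_univ_of_isClosed {n : ℕ} {Z : Set (UnitDisk n)} (hZ : IsClosed Z)
    (h : ∀ y : UnitDisk n, ‖(y : EuclideanSpace ℝ (Fin n))‖ < 1 → y ∈ Z) : Z = univ := by
  have h1 : IsClosed (Subtype.val '' Z : Set (EuclideanSpace ℝ (Fin n))) :=
    (Metric.isClosed_closedBall.isClosedEmbedding_subtypeVal).isClosedMap _ hZ
  have h2 : Metric.ball (0 : EuclideanSpace ℝ (Fin n)) 1 ⊆ Subtype.val '' Z := fun y hy =>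
    ⟨⟨y, Metric.ball_subset_closedBall hy⟩, h _ (mem_ball_zero_iff.1 hy), rfl⟩
  have h3 := closure_minimal h2 h1
  rw [closure_ball _ one_ne_zero] at h3
  refine eq_univ_of_forall fun y => ?_
  obtain ⟨z, hz, hzy⟩ := h3 y.2
  rwa [← Subtype.ext hzy]

namespace GCWStructure

variable {G : Type v} {X : Type u} [Group G] [TopologicalSpace X] [MulAction G X]
  (s : GCWStructure G X)

theorem char_mem_skeleton {m n : ℕ} (h : m < n) (e : s.cell m) (c : G ⧸ s.isotropy m e)
    (y : UnitDisk m) : s.char m e c y ∈ s.skeleton n :=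
  ⟨m, h, e, c, y, rfl⟩

theorem skeleton_mono : Monotone s.skeleton := by
  rintro m n hmn x ⟨k, hk, h⟩
  exact ⟨k, hk.trans_le hmn, h⟩

theorem skeleton_zero : s.skeleton 0 = ∅ := by
  ext x
  constructor
  · rintro ⟨m, hm, -⟩
    exact absurd hm (Nat.not_lt_zero m)
  · exact fun h => h.elim

theorem isClosed_skeleton (n : ℕ) : IsClosed (s.skeleton n) := by
  induction n with
  | zero =>
    rw [skeleton_zero]
    exact isClosed_empty
  | succ n ih =>
    refine s.isClosed_of_cells n _ Subset.rfl ?_ fun e c => ?_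
    · rwa [inter_eq_self_of_subset_right (s.skeleton_mono n.le_succ)]
    · convert isClosed_univ
      exact eq_univ_of_forall fun y => s.char_mem_skeleton n.lt_succ_self e c y

/-- Every point of a skeleton lies in an open cell. -/
theorem exists_interior {n : ℕ} {x : X} (hx : x ∈ s.skeleton n) :
    ∃ m < n, ∃ (e : s.cell m) (c : G ⧸ s.isotropy m e) (y : UnitDisk m),
      ‖(y : EuclideanSpace ℝ (Fin m))‖ < 1 ∧ s.char m e c y = x := by
  induction n with
  | zero =>
    rw [skeleton_zero] at hx
    exact hx.elim
  | succ n ih =>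
    by_cases hxn : x ∈ s.skeleton n
    · obtain ⟨m, hm, h⟩ := ih hxn
      exact ⟨m, hm.trans n.lt_succ_self, h⟩
    · obtain ⟨m, hm, e, c, y, rfl⟩ := hx
      refine ⟨m, hm, e, c, y, (UnitDisk.norm_le y).lt_of_ne fun hy => hxn ?_, rfl⟩
      exact s.skeleton_mono (Nat.le_of_lt_succ hm) (s.sphere_mem m e c y hy)

/-- Translation by `g` carries the open cell of `c` to that of `g • c`, and distinct open cells are
disjoint. -/
theorem smul_eq_of_smul_char {n : ℕ} {e : s.cell n} {c : G ⧸ s.isotropy n e} {y : UnitDisk n}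
    (hy : ‖(y : EuclideanSpace ℝ (Fin n))‖ < 1) {g : G}
    (h : g • s.char n e c y = s.char n e c y) : g • c = c := by
  rw [← s.smul_char] at h
  have := (s.interior_injective n ⟨e, g • c⟩ ⟨e, c⟩ y y hy hy h).1
  simpa using this

/-- A subset is closed as soon as its preimage in every cell is, where one may assume that the
intersection with the lower skeleton is closed. -/
theorem isClosed_of_forall_cell {Z : Set X} (h : ∀ n, IsClosed (Z ∩ s.skeleton n) →
    ∀ e c, IsClosed (s.char n e c ⁻¹' Z)) : IsClosed Z := by
  refine s.isClosed_of_skeleta _ fun n => ?_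
  induction n with
  | zero =>
    rw [skeleton_zero, inter_empty]
    exact isClosed_empty
  | succ n ih =>
    refine s.isClosed_of_cells n _ inter_subset_right ?_ fun e c => ?_
    · rwa [inter_assoc, inter_eq_self_of_subset_right (s.skeleton_mono n.le_succ)]
    · convert h n ih e c using 1
      ext y
      exact and_iff_left (s.char_mem_skeleton n.lt_succ_self e c y)

/-- If `Z` does not meet an open cell, its preimage in the cell only depends on the lower
skeleton. -/
theorem isClosed_preimage_of_interior {Z : Set X} {n : ℕ} (hZ : IsClosed (Z ∩ s.skeleton n))
    (e : s.cell n) (c : G ⧸ s.isotropy n e)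
    (h : ∀ y : UnitDisk n, ‖(y : EuclideanSpace ℝ (Fin n))‖ < 1 → s.char n e c y ∉ Z) :
    IsClosed (s.char n e c ⁻¹' Z) := by
  convert hZ.preimage (s.continuous_char n e c) using 1
  ext y
  refine (and_iff_left_of_imp fun hy => ?_).symm
  exact s.sphere_mem n e c y ((UnitDisk.norm_le y).eq_of_not_lt fun hlt => h y hlt hy)

/-- The preimage of a closed set `Z'` is closed, so this computes preimages of sets that agree with
a closed set on a cell. -/
theorem isClosed_preimage_of_iff {Z Z' : Set X} (hZ' : IsClosed Z') {n : ℕ}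
    (e : s.cell n) (c : G ⧸ s.isotropy n e)
    (h : ∀ y : UnitDisk n, s.char n e c y ∈ Z ↔ s.char n e c y ∈ Z') :
    IsClosed (s.char n e c ⁻¹' Z) := by
  convert hZ'.preimage (s.continuous_char n e c) using 1
  ext y
  exact h y

theorem char_mem_fixedPoints (H : Subgroup G) {n : ℕ} {e : s.cell n} {c : G ⧸ s.isotropy n e}
    (hc : ∀ g ∈ H, g • c = c) (y : UnitDisk n) :
    s.char n e c y ∈ MulAction.fixedPoints H X := by
  rintro ⟨g, hg⟩
  change g • s.char n e c y = _
  rw [← s.smul_char, hc g hg]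

theorem smul_eq_of_char_mem_fixedPoints {H : Subgroup G} {n : ℕ} {e : s.cell n}
    {c : G ⧸ s.isotropy n e} {y : UnitDisk n} (hy : ‖(y : EuclideanSpace ℝ (Fin n))‖ < 1)
    (h : s.char n e c y ∈ MulAction.fixedPoints H X) : ∀ g ∈ H, g • c = c :=
  fun g hg => s.smul_eq_of_smul_char hy (h ⟨g, hg⟩)

/-- A cell whose coset is fixed by `H` lies entirely in the fixed point set, and every other open
cell misses it. No separation axiom is needed. -/
theorem isClosed_fixedPoints (s : GCWStructure G X) (H : Subgroup G) :
    IsClosed (MulAction.fixedPoints H X) := by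
  refine s.isClosed_of_forall_cell fun n hn e c => ?_
  by_cases hc : ∀ g ∈ H, g • c = c
  · convert isClosed_univ
    exact eq_univ_of_forall (s.char_mem_fixedPoints H hc)
  · exact s.isClosed_preimage_of_interior hn e c fun y hy h =>
      hc (s.smul_eq_of_char_mem_fixedPoints hy h)

end GCWStructure

/-- The map of fixed point sets induced by an equivariant map. -/
def fixedPointsMap {G A B : Type*} [Group G] [MulAction G A] [MulAction G B] {i : A → B}
    (hi : ∀ (g : G) a, i (g • a) = g • i a) (H : Subgroup G) (a : MulAction.fixedPoints H A) :
    MulAction.fixedPoints H B :=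
  ⟨i a, fun g => by
    change (g : G) • i a = i a
    rw [← hi]
    exact congrArg i (a.2 g)⟩

theorem continuous_fixedPointsMap {G A B : Type*} [Group G] [MulAction G A] [MulAction G B]
    [TopologicalSpace A] [TopologicalSpace B] {i : A → B} (hc : Continuous i)
    (hi : ∀ (g : G) a, i (g • a) = g • i a) (H : Subgroup G) : Continuous (fixedPointsMap hi H) :=
  (hc.comp continuous_subtype_val).subtype_mk _

theorem mem_fixedPoints_of_map {G A B : Type*} [Group G] [MulAction G A] [MulAction G B]
    {i : A → B} (hinj : Function.Injective i) (hi : ∀ (g : G) a, i (g • a) = g • i a)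
    {H : Subgroup G} {a : A} (h : i a ∈ MulAction.fixedPoints H B) :
    a ∈ MulAction.fixedPoints H A := fun g => hinj ((hi g a).trans (h g))

/-! ### Inclusions of `G`-CW-complexes and their fixed point sets -/

namespace IsGCWInclusion

variable {G : Type v} {A B : Type u} [Group G]
  [TopologicalSpace A] [MulAction G A] [TopologicalSpace B] [MulAction G B]
  {sA : GCWStructure G A} {sB : GCWStructure G B} {i : A → B}

theorem smul_mem_range (hi : IsGCWInclusion sA sB i) (g : G) {b : B} :
    g • b ∈ range i ↔ b ∈ range i := by
  constructor
  · rintro ⟨a, ha⟩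
    exact ⟨g⁻¹ • a, by rw [hi.map_smul, ha, inv_smul_smul]⟩
  · rintro ⟨a, rfl⟩
    exact ⟨g • a, hi.map_smul g a⟩

theorem mem_skeleton_iff (hi : IsGCWInclusion sA sB i) {n : ℕ} {a : A} :
    i a ∈ sB.skeleton n ↔ a ∈ sA.skeleton n := by
  rw [← hi.preimage_skeleton, mem_preimage]

/-- If one interior point of an equivariant cell lies in the subcomplex, then all of the equivariant
cell does. -/
theorem char_mem_range (hi : IsGCWInclusion sA sB i) {n : ℕ} {e : sB.cell n}
    {c : G ⧸ sB.isotropy n e} {y : UnitDisk n} (hy : ‖(y : EuclideanSpace ℝ (Fin n))‖ < 1)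
    (h : sB.char n e c y ∈ range i) (c' : G ⧸ sB.isotropy n e) (z : UnitDisk n) :
    sB.char n e c' z ∈ range i := by
  obtain ⟨g, rfl⟩ := MulAction.exists_smul_eq G c c'
  rw [sB.smul_char, hi.smul_mem_range]
  have h1 := hi.openCell_subset n e c ⟨_, ⟨y, hy, rfl⟩, h⟩
  have h2 := UnitDisk.eq_univ_of_isClosed
    (hi.isClosedEmbedding.isClosed_range.preimage (sB.continuous_char n e c))
    fun z hz => h1 ⟨z, hz, rfl⟩
  exact h2.ge (mem_univ z)

/-- The equivariant cells of `B` that do not lie in the subcomplex `A`. -/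
def newCell (_ : IsGCWInclusion sA sB i) (n : ℕ) : Type u :=
  {e : sB.cell n // ∀ c (y : UnitDisk n), ‖(y : EuclideanSpace ℝ (Fin n))‖ < 1 →
    sB.char n e c y ∉ range i}

theorem newCell_or_mem_range (hi : IsGCWInclusion sA sB i) {n : ℕ} (e : sB.cell n) :
    (∃ e' : hi.newCell n, e'.1 = e) ∨ ∀ c y, sB.char n e c y ∈ range i := by
  by_cases h : ∀ c (y : UnitDisk n), ‖(y : EuclideanSpace ℝ (Fin n))‖ < 1 →
      sB.char n e c y ∉ range i
  · exact Or.inl ⟨⟨e, h⟩, rfl⟩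
  · push Not at h
    obtain ⟨c, y, hy, h⟩ := h
    exact Or.inr (hi.char_mem_range hy h)

/-- For an inclusion `A → B` of `G`-CW-complexes, `B^H` is a relative cell complex over `A^H`. -/
theorem isRelativeCellComplex_fixedPoints (hi : IsGCWInclusion sA sB i) (H : Subgroup G) :
    IsRelativeCellComplex
      (fun n => {x : MulAction.fixedPoints H B | (x : B) ∈ range i ∨ (x : B) ∈ sB.skeleton n})
      (ι := fun n => {p : Σ e : hi.newCell n, G ⧸ sB.isotropy n e.1 // ∀ g ∈ H, g • p.2 = p.2})
      (fun n p y => ⟨sB.char n p.1.1.1 p.1.2 y, sB.char_mem_fixedPoints H p.2 y⟩) := by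
  have hBH := (sB.isClosed_fixedPoints H).isClosedEmbedding_subtypeVal
  refine ⟨fun n p => ?_, fun n => ?_, fun n p y hy => ?_, fun n p y hy => ?_,
    fun n p p' y z hy hz h => ?_, fun n Z hZ hZn hZc => ?_, fun x => ?_, fun Z hZ => ?_⟩
  · exact (sB.continuous_char n _ _).subtype_mk _
  · ext x
    constructor
    · rintro (h | h)
      · exact Or.inl (Or.inl h)
      · obtain ⟨m, hm, e, c, y, hy, hx⟩ := sB.exists_interior h
        rcases (Nat.le_of_lt_succ hm).lt_or_eq with hm | rfl
        · exact Or.inl (Or.inr (hx ▸ sB.char_mem_skeleton hm e c y))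
        · rcases hi.newCell_or_mem_range e with ⟨e', rfl⟩ | he
          · refine Or.inr (mem_iUnion.2 ⟨⟨⟨e', c⟩, ?_⟩, y, Subtype.ext hx⟩)
            refine sB.smul_eq_of_char_mem_fixedPoints hy ?_
            rw [hx]
            exact x.2
          · exact Or.inl (Or.inl (hx ▸ he c y))
    · rintro ((h | h) | h)
      · exact Or.inl h
      · exact Or.inr (sB.skeleton_mono n.le_succ h)
      · obtain ⟨p, y, rfl⟩ := mem_iUnion.1 h
        exact Or.inr (sB.char_mem_skeleton n.lt_succ_self _ _ _)
  · exact Or.inr (sB.sphere_mem n _ _ y hy)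
  · rintro (h | h)
    · exact p.1.1.2 _ y hy h
    · exact sB.interior_notMem n _ _ y hy h
  · obtain ⟨⟨⟨e, he⟩, c⟩, hc⟩ := p
    obtain ⟨⟨⟨e', he'⟩, c'⟩, hc'⟩ := p'
    obtain ⟨h1, rfl⟩ := sB.interior_injective n ⟨e, c⟩ ⟨e', c'⟩ y z hy hz (congrArg Subtype.val h)
    cases h1
    exact ⟨rfl, rfl⟩
  · suffices h : IsClosed (Subtype.val '' Z) by
      rw [← preimage_image_eq Z Subtype.val_injective]
      exact h.preimage continuous_subtype_val
    have hZn' := hBH.isClosedMap _ hZn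
    -- On cells in `A`, and on fixed new cells of dimension below `n`, `Z` agrees with its part in
    -- stage `n`. Dimension `n` is the hypothesis on cells. All other open cells miss `Z`, either
    -- not being fixed by `H` or lying outside stage `n + 1`.
    refine sB.isClosed_of_forall_cell fun m hm e c => ?_
    rcases hi.newCell_or_mem_range e with ⟨e', rfl⟩ | he
    · by_cases hc : ∀ g ∈ H, g • c = c
      · rcases lt_trichotomy m n with hmn | rfl | hmn
        · refine sB.isClosed_preimage_of_iff hZn' _ c fun y => ?_
          constructor
          · rintro ⟨x, hx, hxy⟩
            exact ⟨x, ⟨hx, Or.inr (hxy ▸ sB.char_mem_skeleton hmn _ c y)⟩, hxy⟩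
          · rintro ⟨x, hx, hxy⟩
            exact ⟨x, hx.1, hxy⟩
        · convert hZc ⟨⟨e', c⟩, hc⟩ using 1
          ext y
          constructor
          · rintro ⟨x, hx, hxy⟩
            rw [mem_preimage]
            convert hx
            exact hxy.symm
          · exact fun hy => ⟨_, hy, rfl⟩
        · refine sB.isClosed_preimage_of_interior hm _ c ?_
          rintro y hy ⟨x, hx, hxy⟩
          rcases hZ hx with h | h
          · rw [hxy] at h
            exact e'.2 _ y hy h
          · rw [hxy] at h
            exact sB.interior_notMem m _ c y hy (sB.skeleton_mono hmn h)
      · refine sB.isClosed_preimage_of_interior hm _ c ?_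
        rintro y hy ⟨x, hx, hxy⟩
        refine hc (sB.smul_eq_of_char_mem_fixedPoints hy ?_)
        rw [← hxy]
        exact x.2
    · refine sB.isClosed_preimage_of_iff hZn' _ c fun y => ?_
      constructor
      · rintro ⟨x, hx, hxy⟩
        exact ⟨x, ⟨hx, Or.inl (hxy ▸ he c y)⟩, hxy⟩
      · rintro ⟨x, hx, hxy⟩
        exact ⟨x, hx.1, hxy⟩
  · obtain ⟨n, hn⟩ := sB.exhaust x
    exact ⟨n, Or.inr hn⟩
  · suffices h : IsClosed (Subtype.val '' Z) by
      rw [← preimage_image_eq Z Subtype.val_injective]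
      exact h.preimage continuous_subtype_val
    refine sB.isClosed_of_skeleta _ fun n => ?_
    convert (hBH.isClosedMap _ (hZ n)).inter (sB.isClosed_skeleton n) using 1
    ext b
    constructor
    · rintro ⟨⟨x, hx, rfl⟩, h⟩
      exact ⟨⟨x, ⟨hx, Or.inr h⟩, rfl⟩, h⟩
    · rintro ⟨⟨x, hx, rfl⟩, h⟩
      exact ⟨⟨x, hx.1, rfl⟩, h⟩

theorem isClosedEmbedding_fixedPointsMap (hi : IsGCWInclusion sA sB i) (H : Subgroup G) :
    IsClosedEmbedding (fixedPointsMap hi.map_smul H) := by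
  refine .of_continuous_injective_isClosedMap
    (continuous_fixedPointsMap hi.isClosedEmbedding.continuous _ H)
    (fun a a' h => Subtype.ext (hi.isClosedEmbedding.injective (congrArg Subtype.val h))) ?_
  intro Z hZ
  have h1 := ((sA.isClosed_fixedPoints H).isClosedEmbedding_subtypeVal).isClosedMap _ hZ
  convert (hi.isClosedEmbedding.isClosedMap _ h1).preimage continuous_subtype_val using 1
  ext x
  constructor
  · rintro ⟨a, ha, rfl⟩
    exact ⟨a, ⟨a, ha, rfl⟩, rfl⟩
  · rintro ⟨_, ⟨a, ha, rfl⟩, hx⟩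
    exact ⟨a, ha, Subtype.ext hx⟩

/-- Fixed point sets of inclusions of `G`-CW-complexes are cofibrations. -/
theorem hasHEP_fixedPointsMap (hi : IsGCWInclusion sA sB i) (H : Subgroup G) :
    HasHEP (fixedPointsMap hi.map_smul H) := by
  refine (hi.isRelativeCellComplex_fixedPoints H).hasHEP (hi.isClosedEmbedding_fixedPointsMap H) ?_
  ext x
  rw [mem_ofPred_eq, sB.skeleton_zero]
  constructor
  · rintro (⟨a, ha⟩ | h)
    · refine ⟨⟨a, mem_fixedPoints_of_map hi.isClosedEmbedding.injective hi.map_smul ?_⟩,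
        Subtype.ext ha⟩
      rw [ha]
      exact x.2
    · exact h.elim
  · rintro ⟨a, rfl⟩
    exact Or.inl ⟨a, rfl⟩

end IsGCWInclusion

/-! ### Pushouts of `G`-spaces along inclusions -/

namespace IsGPushout

variable {G : Type v} {A B C X : Type u} [Group G]
  [TopologicalSpace B] [MulAction G B] [TopologicalSpace C] [MulAction G C] [TopologicalSpace X]
  [MulAction G X] {i : A → B} {f : A → C} {j : B → X} {k : C → X}

/-- The universal property with respect to `G`-sets. -/
theorem existsUnique_desc_set (hX : IsGPushout G i f j k) (P : Type u) [MulAction G P] (b : B → P)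
    (c : C → P) (hb : ∀ (g : G) x, b (g • x) = g • b x) (hc : ∀ (g : G) x, c (g • x) = g • c x)
    (h : ∀ a, b (i a) = c (f a)) :
    ∃! d : X → P, (∀ (g : G) x, d (g • x) = g • d x) ∧ (∀ x, d (j x) = b x) ∧
      ∀ x, d (k x) = c x := by
  -- For the indiscrete topology, continuity is no condition.
  let : TopologicalSpace P := ⊤
  have : ContinuousConstSMul G P := ⟨fun _ => continuous_top⟩
  obtain ⟨d, ⟨-, hd⟩, hu⟩ := hX.existsUnique_desc P b c continuous_top hb continuous_top hc h
  exact ⟨d, hd, fun d' hd' => hu d' ⟨continuous_top, hd'⟩⟩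

/-- The indicator of the union of the two images and the constant `True` agree on `B` and on `C`, so
they coincide by uniqueness. -/
theorem jointly_surjective (hX : IsGPushout G i f j k) (x : X) :
    (∃ b, j b = x) ∨ ∃ c, k c = x := by
  let : MulAction G (ULift.{u} Prop) :=
    { smul := fun _ p => p, one_smul := fun _ => rfl, mul_smul := fun _ _ _ => rfl }
  have hu := (hX.existsUnique_desc_set (ULift.{u} Prop) (fun _ => ⟨True⟩) (fun _ => ⟨True⟩)
    (fun _ _ => rfl) (fun _ _ => rfl) fun _ => rfl).unique
    (y₁ := fun x => ⟨(∃ b, j b = x) ∨ ∃ c, k c = x⟩) (y₂ := fun _ => ⟨True⟩)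
    ⟨fun g x => ?_, fun b => ?_, fun c => ?_⟩
    ⟨fun _ _ => rfl, fun _ => rfl, fun _ => rfl⟩
  · have := congrArg ULift.down (congrFun hu x)
    exact this.mpr trivial
  · refine congrArg ULift.up (propext ?_)
    constructor
    · rintro (⟨b, hb⟩ | ⟨c, hc⟩)
      · exact Or.inl ⟨g⁻¹ • b, by rw [hX.map_smul_left, hb, inv_smul_smul]⟩
      · exact Or.inr ⟨g⁻¹ • c, by rw [hX.map_smul_right, hc, inv_smul_smul]⟩
    · rintro (⟨b, rfl⟩ | ⟨c, rfl⟩)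
      · exact Or.inl ⟨g • b, hX.map_smul_left g b⟩
      · exact Or.inr ⟨g • c, hX.map_smul_right g c⟩
  · exact congrArg ULift.up (eq_true (Or.inl ⟨b, rfl⟩))
  · exact congrArg ULift.up (eq_true (Or.inr ⟨c, rfl⟩))

/-- The set `X` with the final topology `t` for `j` and `k` also receives a map from the pushout.
That map is the identity on points, so `t`-closed sets are closed in `X`. -/
theorem isClosed_of_preimage [ContinuousConstSMul G B] [ContinuousConstSMul G C]
    (hX : IsGPushout G i f j k) {Z : Set X} (hj : IsClosed (j ⁻¹' Z)) (hk : IsClosed (k ⁻¹' Z)) :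
    IsClosed Z := by
  have hdesc := @hX.existsUnique_desc X
  have hjs := hX.map_smul_left
  have hks := hX.map_smul_right
  have hcomm := hX.comm
  have hsurj := hX.jointly_surjective
  have hpre (Y : Type u) [TopologicalSpace Y] (d : X → Y) (hd : Continuous d) {Z : Set Y} :
      IsClosed Z → IsClosed (d ⁻¹' Z) := fun hZ => hZ.preimage hd
  let t : TopologicalSpace X := .coinduced j ‹_› ⊔ .coinduced k ‹_›
  have htj : Continuous[_, t] j := continuous_iff_coinduced_le.2 le_sup_left
  have htk : Continuous[_, t] k := continuous_iff_coinduced_le.2 le_sup_right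
  have hsmul : @ContinuousConstSMul G X t _ := by
    refine @ContinuousConstSMul.mk G X t _ fun g => ?_
    refine continuous_sup_dom.2 ⟨continuous_coinduced_dom.2 ?_, continuous_coinduced_dom.2 ?_⟩
    · have h : (fun x : X => g • x) ∘ j = j ∘ fun b => g • b :=
        funext fun b => (hjs g b).symm
      rw [h]
      exact htj.comp (continuous_const_smul g)
    · have h : (fun x : X => g • x) ∘ k = k ∘ fun c => g • c :=
        funext fun c => (hks g c).symm
      rw [h]
      exact htk.comp (continuous_const_smul g)
  obtain ⟨d, ⟨hd, -, hdj, hdk⟩, -⟩ := @hdesc t _ hsmul j k htj hjs htk hks hcomm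
  have hdid : d = id := funext fun x => by
    rcases hsurj x with ⟨b, rfl⟩ | ⟨c, rfl⟩
    · exact hdj b
    · exact hdk c
  have hZ : IsClosed[t] Z :=
    (@isOpen_compl_iff X Z t).1 ⟨hj.isOpen_compl, hk.isOpen_compl⟩
  have h := @hpre X t d hd Z hZ
  rwa [hdid] at h

/-- A pushout of `G`-spaces along an injective map is the space obtained by gluing. -/
theorem isGluing [ContinuousConstSMul G B] [ContinuousConstSMul G C] [MulAction G A]
    (hX : IsGPushout G i f j k) (hinj : Function.Injective i)
    (hi : ∀ (g : G) a, i (g • a) = g • i a) (hf : ∀ (g : G) a, f (g • a) = g • f a) :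
    IsGluing i f j k := by
  classical
  have hrange : ∀ (g : G) b, b ∉ range i → g • b ∉ range i := by
    rintro g b hb ⟨a, ha⟩
    exact hb ⟨g⁻¹ • a, by rw [hi, ha, inv_smul_smul]⟩
  -- The concrete pushout of sets. Mapping `X` to it detects which points of `B` and `C` are
  -- identified.
  let : MulAction G ({b : B // b ∉ range i} ⊕ C) :=
    { smul := fun g => Sum.map (fun b => ⟨g • b.1, hrange g b.1 b.2⟩) (g • ·)
      one_smul := by
        rintro (⟨b, hb⟩ | c)
        · exact congrArg Sum.inl (Subtype.ext (one_smul G b))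
        · exact congrArg Sum.inr (one_smul G c)
      mul_smul := by
        rintro g g' (⟨b, hb⟩ | c)
        · exact congrArg Sum.inl (Subtype.ext (mul_smul g g' b))
        · exact congrArg Sum.inr (mul_smul g g' c) }
  let p : B → {b : B // b ∉ range i} ⊕ C := fun b =>
    if h : b ∈ range i then Sum.inr (f h.choose) else Sum.inl ⟨b, h⟩
  have hpi : ∀ a, p (i a) = Sum.inr (f a) := fun a => by
    have h : i a ∈ range i := ⟨a, rfl⟩
    simp only [p]
    rw [dif_pos h, hinj h.choose_spec]
  have hpn : ∀ b (h : b ∉ range i), p b = Sum.inl ⟨b, h⟩ := fun b h => dif_neg h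
  obtain ⟨d, ⟨-, hdj, hdk⟩, -⟩ := hX.existsUnique_desc_set ({b : B // b ∉ range i} ⊕ C) p Sum.inr
    (fun g b => by
      by_cases h : b ∈ range i
      · obtain ⟨a, rfl⟩ := h
        rw [← hi, hpi, hpi, hf]
        rfl
      · rw [hpn b h, hpn _ (hrange g b h)]
        rfl)
    (fun _ _ => rfl) hpi
  refine ⟨hX.continuous_left, hX.continuous_right, hX.comm, hX.jointly_surjective,
    fun c c' h => ?_, fun b c h => ?_, fun b b' h => ?_, fun Z => hX.isClosed_of_preimage⟩
  · have := congrArg d h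
    rw [hdk, hdk] at this
    exact Sum.inr_injective this
  · have := congrArg d h
    rw [hdk, hdj] at this
    by_cases hb : b ∈ range i
    · obtain ⟨a, rfl⟩ := hb
      rw [hpi] at this
      exact ⟨a, rfl, Sum.inr_injective this⟩
    · rw [hpn b hb] at this
      exact (Sum.inl_ne_inr this).elim
  · by_cases hb : b ∈ range i
    · exact Or.inr hb
    · have := congrArg d h
      rw [hdj, hdj, hpn b hb] at this
      by_cases hb' : b' ∈ range i
      · obtain ⟨a, rfl⟩ := hb'
        rw [hpi] at this
        exact (Sum.inl_ne_inr this).elim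
      · rw [hpn b' hb'] at this
        exact Or.inl (congrArg Subtype.val (Sum.inl_injective this))

end IsGPushout

/-! ### Fixed points and cell structures of gluings -/

namespace IsGluing

section

variable {G : Type v} {A B C X : Type u} [Group G] [MulAction G A]
  [TopologicalSpace B] [MulAction G B] [TopologicalSpace C] [TopologicalSpace X]
  [MulAction G X] {i : A → B} {f : A → C} {j : B → X} {k : C → X}

/-- Off the invariant subset `A`, the map `j` is injective, so fixedness can be tested in `X`. -/
theorem mem_fixedPoints_left (hX : IsGluing i f j k) (hi : ∀ (g : G) a, i (g • a) = g • i a)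
    (hj : ∀ (g : G) b, j (g • b) = g • j b) {H : Subgroup G} {b : B} (hb : b ∉ range i)
    (h : j b ∈ MulAction.fixedPoints H X) : b ∈ MulAction.fixedPoints H B := by
  intro g
  have h1 : j (g • b) = j b := (hj g b).trans (h g)
  rcases hX.left_eq_left _ _ h1 with h2 | ⟨a, ha⟩
  · exact h2
  · refine (hb ⟨(g : G)⁻¹ • a, ?_⟩).elim
    rw [hi, ha]
    exact inv_smul_smul (g : G) b

/-- Fixed point sets of a gluing are obtained by gluing the fixed point sets. -/
theorem fixedPoints [TopologicalSpace A] [MulAction G C] (hX : IsGluing i f j k)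
    (hic : IsClosedEmbedding i) (hfc : Continuous f)
    (hi : ∀ (g : G) a, i (g • a) = g • i a) (hf : ∀ (g : G) a, f (g • a) = g • f a)
    (hj : ∀ (g : G) b, j (g • b) = g • j b) (hk : ∀ (g : G) c, k (g • c) = g • k c)
    (H : Subgroup G) (hB : IsClosed (MulAction.fixedPoints H B))
    (hC : IsClosed (MulAction.fixedPoints H C)) :
    IsGluing (fixedPointsMap hi H) (fixedPointsMap hf H) (fixedPointsMap hj H)
      (fixedPointsMap hk H) := by
  refine ⟨continuous_fixedPointsMap hX.continuous_left hj H,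
    continuous_fixedPointsMap hX.continuous_right hk H, fun a => Subtype.ext (hX.comm a),
    fun ⟨x, hx⟩ => ?_,
    fun c c' h => Subtype.ext (hX.injective_right (congrArg Subtype.val h)), fun b c h => ?_,
    fun b b' h => ?_, fun Z hZj hZk => ?_⟩
  · have hkx : ∀ c, k c = x → ∃ c, fixedPointsMap hk H c = ⟨x, hx⟩ := by
      rintro c rfl
      exact ⟨⟨c, mem_fixedPoints_of_map hX.injective_right hk hx⟩, rfl⟩
    rcases hX.surj x with ⟨b, rfl⟩ | ⟨c, hc⟩
    · by_cases hb : b ∈ range i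
      · obtain ⟨a, rfl⟩ := hb
        exact Or.inr (hkx _ (hX.comm a).symm)
      · exact Or.inl ⟨⟨b, hX.mem_fixedPoints_left hi hj hb hx⟩, rfl⟩
    · exact Or.inr (hkx c hc)
  · obtain ⟨a, ha, hac⟩ := hX.left_eq_right b c (congrArg Subtype.val h)
    exact ⟨⟨a, mem_fixedPoints_of_map hic.injective hi (ha ▸ b.2)⟩, Subtype.ext ha,
      Subtype.ext hac⟩
  · refine (hX.left_eq_left b b' (congrArg Subtype.val h)).imp Subtype.ext ?_
    rintro ⟨a, ha⟩
    exact ⟨⟨a, mem_fixedPoints_of_map hic.injective hi (ha ▸ b.2)⟩, Subtype.ext ha⟩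
  · have hZk' := hC.isClosedEmbedding_subtypeVal.isClosedMap _ hZk
    have hk_eq : k ⁻¹' (Subtype.val '' Z) = Subtype.val '' (fixedPointsMap hk H ⁻¹' Z) := by
      ext c
      constructor
      · rintro ⟨x, hx, hxc⟩
        refine ⟨⟨c, mem_fixedPoints_of_map hX.injective_right hk (hxc ▸ x.2)⟩, ?_, rfl⟩
        rw [mem_preimage]
        convert hx
        exact Subtype.ext hxc.symm
      · rintro ⟨c, hc, rfl⟩
        exact ⟨_, hc, rfl⟩
    rw [← preimage_image_eq Z Subtype.val_injective]
    refine IsClosed.preimage continuous_subtype_val (hX.isClosed_of_preimage _ ?_ ?_)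
    -- The second piece is needed because `f` may enlarge stabilizers: a point of `A` can become
    -- `H`-fixed in `C` without being so in `B`.
    · have h1 := hB.isClosedEmbedding_subtypeVal.isClosedMap _ hZj
      have h2 := hic.isClosedMap _ (hZk'.preimage hfc)
      convert h1.union h2 using 1
      ext b
      constructor
      · rintro ⟨x, hx, hxb⟩
        by_cases hb : b ∈ range i
        · obtain ⟨a, rfl⟩ := hb
          refine Or.inr ⟨a, ?_, rfl⟩
          rw [← hk_eq]
          exact ⟨x, hx, hxb.trans (hX.comm a)⟩
        · refine Or.inl ⟨⟨b, hX.mem_fixedPoints_left hi hj hb (hxb ▸ x.2)⟩, ?_, rfl⟩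
          rw [mem_preimage]
          convert hx
          exact Subtype.ext hxb.symm
      · rintro (⟨b, hb, rfl⟩ | ⟨a, ha, rfl⟩)
        · exact ⟨_, hb, rfl⟩
        · rw [← hk_eq] at ha
          rw [mem_preimage, hX.comm]
          exact ha
    · rwa [hk_eq]

end

/-- The equivariant cells of a gluing of `G`-CW-complexes: those of `C`, and those of `B` outside
`A`. -/
def cells {G : Type v} {A B C X : Type u} [Group G]
    [TopologicalSpace A] [MulAction G A] [TopologicalSpace B] [MulAction G B]
    [TopologicalSpace C] [MulAction G C] {sA : GCWStructure G A} {sB : GCWStructure G B}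
    {i : A → B} (hi : IsGCWInclusion sA sB i) (sC : GCWStructure G C) (j : B → X) (k : C → X) :
    EquivariantCells G X where
  cell n := hi.newCell n ⊕ sC.cell n
  isotropy n := Sum.elim (fun e => sB.isotropy n e.1) (sC.isotropy n)
  char n
    | .inl e => fun c y => j (sB.char n e.1 c y)
    | .inr e => fun c y => k (sC.char n e c y)

section

variable {G : Type v} {A B C X : Type u} [Group G] [TopologicalSpace A] [MulAction G A]
  [TopologicalSpace B] [MulAction G B] [TopologicalSpace C] [MulAction G C] [TopologicalSpace X]
  {i : A → B} {f : A → C} {j : B → X} {k : C → X}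
  {sA : GCWStructure G A} {sB : GCWStructure G B} {sC : GCWStructure G C}

/-- Cellularity of `f` is what places the points of a skeleton of `B` that lie in `A` into the same
skeleton of `C`. -/
theorem skeleton_cells (hX : IsGluing i f j k) (hi : IsGCWInclusion sA sB i)
    (hcell : ∀ n, MapsTo f (sA.skeleton n) (sC.skeleton n)) (n : ℕ) :
    (cells hi sC j k).skeleton n = j '' sB.skeleton n ∪ k '' sC.skeleton n := by
  ext x
  constructor
  · rintro ⟨m, hm, e | e, c, y, rfl⟩
    · exact Or.inl ⟨_, sB.char_mem_skeleton hm e.1 c y, rfl⟩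
    · exact Or.inr ⟨_, sC.char_mem_skeleton hm e c y, rfl⟩
  · have hk : ∀ z ∈ sC.skeleton n, k z ∈ (cells hi sC j k).skeleton n := by
      rintro _ ⟨m, hm, e, c, y, rfl⟩
      exact ⟨m, hm, Sum.inr e, c, y, rfl⟩
    rintro (⟨b, hb, rfl⟩ | ⟨z, hz, rfl⟩)
    · by_cases hbi : b ∈ range i
      · obtain ⟨a, rfl⟩ := hbi
        rw [hX.comm]
        exact hk _ (hcell n (hi.mem_skeleton_iff.1 hb))
      · obtain ⟨m, hm, e, c, y, rfl⟩ := hb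
        rcases hi.newCell_or_mem_range e with ⟨e', rfl⟩ | he
        · exact ⟨m, hm, Sum.inl e', c, y, rfl⟩
        · exact (hbi (he c y)).elim
    · exact hk z hz

theorem right_mem_skeleton (hX : IsGluing i f j k) (hi : IsGCWInclusion sA sB i)
    (hcell : ∀ n, MapsTo f (sA.skeleton n) (sC.skeleton n)) {n : ℕ} {c : C} :
    k c ∈ (cells hi sC j k).skeleton n ↔ c ∈ sC.skeleton n := by
  rw [hX.skeleton_cells hi hcell]
  constructor
  · rintro (⟨b, hb, hbc⟩ | ⟨c', hc', h⟩)
    · obtain ⟨a, rfl, rfl⟩ := hX.left_eq_right b c hbc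
      exact hcell n (hi.mem_skeleton_iff.1 hb)
    · rwa [← hX.injective_right h]
  · exact fun h => Or.inr ⟨c, h, rfl⟩

theorem left_mem_skeleton (hX : IsGluing i f j k) (hi : IsGCWInclusion sA sB i)
    (hcell : ∀ n, MapsTo f (sA.skeleton n) (sC.skeleton n)) {n : ℕ} {b : B} (hb : b ∉ range i) :
    j b ∈ (cells hi sC j k).skeleton n ↔ b ∈ sB.skeleton n := by
  rw [hX.skeleton_cells hi hcell]
  constructor
  · rintro (⟨b', hb', h⟩ | ⟨c, hc, h⟩)
    · rcases hX.left_eq_left b b' h.symm with rfl | h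
      · exact hb'
      · exact (hb h).elim
    · obtain ⟨a, ha, -⟩ := hX.left_eq_right b c h.symm
      exact (hb ⟨a, ha⟩).elim
  · exact fun h => Or.inl ⟨b, h, rfl⟩

/-- The pushout of `G`-CW-complexes along an inclusion and a cellular map is a
`G`-CW-complex. -/
def gcwStructure [MulAction G X] (hX : IsGluing i f j k) (hi : IsGCWInclusion sA sB i)
    (hf : Continuous f) (hcell : ∀ n, MapsTo f (sA.skeleton n) (sC.skeleton n))
    (hj : ∀ (g : G) b, j (g • b) = g • j b) (hk : ∀ (g : G) c, k (g • c) = g • k c) :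
    GCWStructure G X where
  toEquivariantCells := cells hi sC j k
  continuous_char := by
    rintro n (e | e) c
    · exact hX.continuous_left.comp (sB.continuous_char n e.1 c)
    · exact hX.continuous_right.comp (sC.continuous_char n e c)
  smul_char := by
    rintro n (e | e) g c y
    · exact (congrArg j (sB.smul_char n e.1 g c y)).trans (hj g _)
    · exact (congrArg k (sC.smul_char n e g c y)).trans (hk g _)
  sphere_mem := by
    rintro n (e | e) c y hy
    · rw [hX.skeleton_cells hi hcell]
      exact Or.inl ⟨_, sB.sphere_mem n e.1 c y hy, rfl⟩
    · exact (hX.right_mem_skeleton hi hcell).2 (sC.sphere_mem n e c y hy)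
  interior_notMem := by
    rintro n (e | e) c y hy
    · exact (hX.left_mem_skeleton hi hcell (e.2 c y hy)).not.2 (sB.interior_notMem n e.1 c y hy)
    · exact (hX.right_mem_skeleton hi hcell).not.2 (sC.interior_notMem n e c y hy)
  interior_injective := by
    rintro n ⟨⟨e, he⟩ | e, c⟩ ⟨⟨e', he'⟩ | e', c'⟩ y z hy hz h
    · rcases hX.left_eq_left _ _ h with h | h
      · obtain ⟨h1, h2⟩ := sB.interior_injective n ⟨e, c⟩ ⟨e', c'⟩ y z hy hz h
        cases h1
        exact ⟨rfl, h2⟩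
      · exact (he c y hy h).elim
    · obtain ⟨a, ha, -⟩ := hX.left_eq_right _ _ h
      exact (he c y hy ⟨a, ha⟩).elim
    · obtain ⟨a, ha, -⟩ := hX.left_eq_right _ _ h.symm
      exact (he' c' z hz ⟨a, ha⟩).elim
    · obtain ⟨h1, h2⟩ := sC.interior_injective n ⟨e, c⟩ ⟨e', c'⟩ y z hy hz
        (hX.injective_right h)
      cases h1
      exact ⟨rfl, h2⟩
  isClosed_of_cells := by
    intro n Z hZ hZn hZc
    have hkZ : IsClosed (k ⁻¹' Z) := by
      refine sC.isClosed_of_cells n _ (fun c hc => (hX.right_mem_skeleton hi hcell).1 (hZ hc)) ?_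
        fun e c => hZc (Sum.inr e) c
      convert hZn.preimage hX.continuous_right using 1
      ext c
      exact and_congr_right fun _ => (hX.right_mem_skeleton hi hcell).symm
    refine hX.isClosed_of_preimage Z ?_ hkZ
    -- Over cells in `A` the preimage is governed by `k ⁻¹' Z`, pulled back through `f`; new cells
    -- are sorted by dimension relative to `n`.
    refine sB.isClosed_of_forall_cell fun m hm e c => ?_
    rcases hi.newCell_or_mem_range e with ⟨e', rfl⟩ | he
    · rcases lt_trichotomy m n with hmn | rfl | hmn
      · refine sB.isClosed_preimage_of_iff (hZn.preimage hX.continuous_left) _ c fun y => ?_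
        refine (and_iff_left ?_).symm
        exact ⟨m, hmn, Sum.inl e', c, y, rfl⟩
      · exact hZc (Sum.inl e') c
      · refine sB.isClosed_preimage_of_interior hm _ c fun y hy h => ?_
        exact sB.interior_notMem m _ c y hy (sB.skeleton_mono hmn
          ((hX.left_mem_skeleton hi hcell (e'.2 c y hy)).1 (hZ h)))
    · refine sB.isClosed_preimage_of_iff (hi.isClosedEmbedding.isClosedMap _ (hkZ.preimage hf))
        e c fun y => ?_
      obtain ⟨a, ha⟩ := he c y
      rw [← ha, hi.isClosedEmbedding.injective.mem_set_image, mem_preimage, mem_preimage,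
        mem_preimage, hX.comm]
  exhaust := by
    intro x
    rcases hX.surj x with ⟨b, rfl⟩ | ⟨c, rfl⟩
    · obtain ⟨n, hn⟩ := sB.exhaust b
      refine ⟨n, ?_⟩
      rw [hX.skeleton_cells hi hcell]
      exact Or.inl ⟨b, hn, rfl⟩
    · obtain ⟨n, hn⟩ := sC.exhaust c
      exact ⟨n, (hX.right_mem_skeleton hi hcell).2 hn⟩
  isClosed_of_skeleta := by
    intro Z hZ
    refine hX.isClosed_of_preimage Z (sB.isClosed_of_skeleta _ fun n => ?_)
      (sC.isClosed_of_skeleta _ fun n => ?_)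
    · convert ((hZ n).preimage hX.continuous_left).inter (sB.isClosed_skeleton n) using 1
      ext b
      constructor
      · rintro ⟨h1, h2⟩
        refine ⟨⟨h1, ?_⟩, h2⟩
        rw [hX.skeleton_cells hi hcell]
        exact Or.inl ⟨b, h2, rfl⟩
      · rintro ⟨⟨h1, -⟩, h2⟩
        exact ⟨h1, h2⟩
    · convert (hZ n).preimage hX.continuous_right using 1
      ext c
      exact and_congr_right fun _ => (hX.right_mem_skeleton hi hcell).symm

end

end IsGluing

/-! ### Restriction of CW-structures along surjective homomorphisms -/

section Restrict

variable {V W : Type*} [Group V] [Group W] (φ : V →* W) (K : Subgroup W)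

/-- The map `V/φ⁻¹(K) → W/K`. -/
def quotientComapMap : V ⧸ K.comap φ → W ⧸ K :=
  Quotient.map' φ fun a b h => by
    rw [QuotientGroup.leftRel_apply] at h ⊢
    simpa using h

theorem quotientComapMap_mk (g : V) : quotientComapMap φ K (g : V ⧸ K.comap φ) = (φ g : W ⧸ K) :=
  rfl

theorem quotientComapMap_injective : Function.Injective (quotientComapMap φ K) := by
  intro a b
  induction a using QuotientGroup.induction_on with | H a => ?_
  induction b using QuotientGroup.induction_on with | H b => ?_
  rw [quotientComapMap_mk, quotientComapMap_mk, QuotientGroup.eq, QuotientGroup.eq,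
    Subgroup.mem_comap, map_mul, map_inv]
  exact id

theorem quotientComapMap_surjective (hφ : Function.Surjective φ) :
    Function.Surjective (quotientComapMap φ K) := by
  intro a
  induction a using QuotientGroup.induction_on with | H a => ?_
  obtain ⟨g, rfl⟩ := hφ a
  exact ⟨g, rfl⟩

theorem quotientComapMap_smul (g : V) (c : V ⧸ K.comap φ) :
    quotientComapMap φ K (g • c) = φ g • quotientComapMap φ K c := by
  induction c using QuotientGroup.induction_on with | H c => ?_
  exact congrArg QuotientGroup.mk (map_mul φ g c)

end Restrict

namespace GCWStructure

variable {V : Type v} {W : Type*} {C : Type u} [Group V] [Group W] [TopologicalSpace C]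
  [MulAction W C]

/-- The cells of a `W`-CW-complex as cells of a `V`-space, for `φ : V → W`. -/
def restrictCells (s : GCWStructure W C) (φ : V →* W) : EquivariantCells V C where
  cell := s.cell
  isotropy n e := (s.isotropy n e).comap φ
  char n e c y := s.char n e (quotientComapMap φ _ c) y

theorem skeleton_restrictCells (s : GCWStructure W C) {φ : V →* W} (hφ : Function.Surjective φ)
    (n : ℕ) : (s.restrictCells φ).skeleton n = s.skeleton n := by
  ext x
  constructor
  · rintro ⟨m, hm, e, c, y, rfl⟩
    exact ⟨m, hm, e, _, y, rfl⟩
  · rintro ⟨m, hm, e, c, y, rfl⟩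
    obtain ⟨c, rfl⟩ := quotientComapMap_surjective φ _ hφ c
    exact ⟨m, hm, e, c, y, rfl⟩

/-- A `W`-CW-complex is a `V`-CW-complex by restriction along a surjection `V → W`. -/
def restrict [MulAction V C] (s : GCWStructure W C) {φ : V →* W} (hφ : Function.Surjective φ)
    (h : ∀ (g : V) (c : C), g • c = φ g • c) : GCWStructure V C where
  toEquivariantCells := s.restrictCells φ
  continuous_char n e c := s.continuous_char n e _
  smul_char n e g c y :=
    (congrArg (fun c' => s.char n e c' y) (quotientComapMap_smul φ _ g c)).trans
      ((s.smul_char n e (φ g) _ y).trans (h g _).symm)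
  sphere_mem n e c y hy := by
    rw [s.skeleton_restrictCells hφ]
    exact s.sphere_mem n e _ y hy
  interior_notMem n e c y hy := by
    rw [s.skeleton_restrictCells hφ]
    exact s.interior_notMem n e _ y hy
  interior_injective := by
    rintro n ⟨e, c⟩ ⟨e', c'⟩ y z hy hz heq
    obtain ⟨h1, h2⟩ := s.interior_injective n ⟨e, quotientComapMap φ _ c⟩
      ⟨e', quotientComapMap φ _ c'⟩ y z hy hz heq
    refine ⟨?_, h2⟩
    obtain rfl : e = e' := congrArg Sigma.fst h1
    have h3 := quotientComapMap_injective φ _ (eq_of_heq (Sigma.mk.inj h1).2)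
    rw [h3]
  isClosed_of_cells n Z hZ hZn hZc := by
    rw [s.skeleton_restrictCells hφ] at hZ hZn
    refine s.isClosed_of_cells n Z hZ hZn fun e c => ?_
    obtain ⟨c, rfl⟩ := quotientComapMap_surjective φ _ hφ c
    exact hZc e c
  exhaust x := by
    obtain ⟨n, hn⟩ := s.exhaust x
    exact ⟨n, by rwa [s.skeleton_restrictCells hφ]⟩
  isClosed_of_skeleta Z hZ := by
    refine s.isClosed_of_skeleta Z fun n => ?_
    rw [← s.skeleton_restrictCells hφ]
    exact hZ n

end GCWStructure

end

/-! ### Subgroups of virtually cyclic groups -/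

section Group

theorem eq_one_of_isOfFinOrder_of_mulEquiv_int {N : Type*} [Group N]
    (e : N ≃* Multiplicative ℤ) {x : N} (hx : IsOfFinOrder x) : x = 1 := by
  have h1 : IsOfFinOrder (e x) := e.toMonoidHom.isOfFinOrder hx
  have h2 : e x = 1 := (isOfFinOrder_iff_eq_one _).1 h1
  simpa using h2

/-- The kernel of a surjection of `D_∞` onto `ℤ/2` that is infinite cyclic consists of the
rotations. -/
theorem dihedral_sr_notMem_ker {pD : DihedralGroup 0 →* Multiplicative (ZMod 2)}
    (e : pD.ker ≃* Multiplicative ℤ) (m : ZMod 0) : pD (.sr m) ≠ 1 := by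
  intro h
  have h1 : IsOfFinOrder (⟨.sr m, h⟩ : pD.ker) := by
    rw [isOfFinOrder_iff_pow_eq_one]
    exact ⟨2, by norm_num, Subtype.ext (by rw [sq]; exact DihedralGroup.sr_mul_self m)⟩
  have h2 := congrArg Subtype.val (eq_one_of_isOfFinOrder_of_mulEquiv_int e h1)
  rw [Subgroup.coe_one, DihedralGroup.one_def] at h2
  cases h2

/-- A rotation is a product of two reflections, and both go to the nontrivial element of ℤ/2. -/
theorem dihedral_r_mem_ker {pD : DihedralGroup 0 →* Multiplicative (ZMod 2)}
    (e : pD.ker ≃* Multiplicative ℤ) (m : ZMod 0) : pD (.r m) = 1 := by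
  have h0 : ∀ a b : Multiplicative (ZMod 2), a ≠ 1 → b ≠ 1 → a * b = 1 := by decide
  have h1 : (DihedralGroup.sr 0 * .sr m : DihedralGroup 0) = .r m := by
    rw [DihedralGroup.sr_mul_sr, sub_zero]
  rw [← h1, map_mul]
  exact h0 _ _ (dihedral_sr_notMem_ker e 0) (dihedral_sr_notMem_ker e m)

theorem dihedral_isOfFinOrder_r {m : ZMod 0} (h : IsOfFinOrder (DihedralGroup.r m)) : m = 0 := by
  obtain ⟨n, hn, h⟩ := isOfFinOrder_iff_pow_eq_one.1 h
  rw [DihedralGroup.r_pow, DihedralGroup.one_def, DihedralGroup.r.injEq] at h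
  have h' : m = 0 ∨ ((n : ℤ) : ZMod 0) = 0 := mul_eq_zero.1 (by exact_mod_cast h)
  refine h'.resolve_right fun h' => hn.ne' ?_
  exact_mod_cast (h' : (n : ℤ) = 0)

/-- An extension of an infinite cyclic group by a finite group splits. -/
theorem exists_mulEquiv_semidirectProduct {N : Type v} [Group N] {q : N →* Multiplicative ℤ}
    (hq : Function.Surjective q) [Finite q.ker] :
    ∃ (F : Type v) (_ : Group F) (_ : Finite F) (φ : Multiplicative ℤ →* MulAut F),
      Nonempty (N ≃* F ⋊[φ] Multiplicative ℤ) := by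
  -- As ℤ is free, any lift of a generator defines a section.
  obtain ⟨t, ht⟩ := hq (.ofAdd 1)
  have hqt : ∀ z, q (zpowersHom N t z) = z := fun z => by
    rw [zpowersHom_apply, map_zpow, ht, ← ofAdd_zsmul, smul_eq_mul, mul_one]
    rfl
  let φ : Multiplicative ℤ →* MulAut q.ker := MulAut.conjNormal.comp (zpowersHom N t)
  let ψ : q.ker ⋊[φ] Multiplicative ℤ →* N :=
    SemidirectProduct.lift q.ker.subtype (zpowersHom N t) fun z => by
      ext x
      change (MulAut.conjNormal (zpowersHom N t z) x : N) = _
      rw [MulAut.conjNormal_apply]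
      rfl
  refine ⟨q.ker, inferInstance, inferInstance, φ,
    ⟨(MulEquiv.ofBijective ψ ⟨?_, fun x => ?_⟩).symm⟩⟩
  · rw [injective_iff_map_eq_one]
    rintro ⟨x, z⟩ h
    have h1 : (x : N) * zpowersHom N t z = 1 := h
    have h2 : z = 1 := by
      have := congrArg q h1
      rwa [map_mul, hqt, map_one, MonoidHom.mem_ker.1 x.2, one_mul] at this
    subst h2
    rw [map_one, mul_one] at h1
    exact SemidirectProduct.ext (Subtype.ext h1) rfl
  · refine ⟨⟨⟨x * (zpowersHom N t (q x))⁻¹, ?_⟩, q x⟩, ?_⟩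
    · rw [MonoidHom.mem_ker, map_mul, map_inv, hqt, mul_inv_cancel]
    · change x * (zpowersHom N t (q x))⁻¹ * zpowersHom N t (q x) = x
      rw [inv_mul_cancel_right]

variable {V : Type v} [Group V] {pV : V →* DihedralGroup 0}
  {pD : DihedralGroup 0 →* Multiplicative (ZMod 2)}

/-- The image of `H` is a torsion subgroup of the infinite cyclic group `pD.ker`, hence trivial. -/
theorem finite_subgroup_le_ker (e : pD.ker ≃* Multiplicative ℤ) {H : Subgroup V} [Finite H]
    (hH : H ≤ (pD.comp pV).ker) : H ≤ pV.ker := by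
  intro g hg
  have h1 : IsOfFinOrder g := by
    have := isOfFinOrder_of_finite (⟨g, hg⟩ : H)
    exact H.subtype.isOfFinOrder this
  have h2 : IsOfFinOrder (⟨pV g, hH hg⟩ : pD.ker) := by
    rw [← Submonoid.isOfFinOrder_coe]
    exact pV.isOfFinOrder h1
  exact congrArg Subtype.val (eq_one_of_isOfFinOrder_of_mulEquiv_int e h2)

/-- An infinite finite-by-cyclic subgroup of `V` lies over the rotations. -/
theorem le_ker_of_mulEquiv_semidirectProduct [Finite pV.ker] (e : pD.ker ≃* Multiplicative ℤ)
    {H : Subgroup V} {F : Type*} [Group F] [Finite F] {φ : Multiplicative ℤ →* MulAut F}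
    (E : H ≃* F ⋊[φ] Multiplicative ℤ) : H ≤ (pD.comp pV).ker := by
  intro g hg
  rw [MonoidHom.mem_ker, MonoidHom.comp_apply]
  rcases hgr : pV g with m | m
  · exact dihedral_r_mem_ker e m
  exfalso
  let t : F ⋊[φ] Multiplicative ℤ := SemidirectProduct.inr (.ofAdd 1)
  let τ : H := E.symm t
  -- Otherwise a power of `τ` lies in the finite group `pV.ker`, and `τ` would be torsion although
  -- it maps to a generator of ℤ.
  have hτ : ¬ IsOfFinOrder (pV τ) := by
    intro h
    obtain ⟨n, hn, h⟩ := isOfFinOrder_iff_pow_eq_one.1 h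
    have h1 : IsOfFinOrder ((τ : V) ^ n) := by
      have := isOfFinOrder_of_finite (⟨(τ : V) ^ n, by rwa [MonoidHom.mem_ker, map_pow]⟩ : pV.ker)
      exact pV.ker.subtype.isOfFinOrder this
    have h2 : IsOfFinOrder τ := by
      rw [← Submonoid.isOfFinOrder_coe]
      exact (isOfFinOrder_pow.1 h1).resolve_right hn.ne'
    have h3 : IsOfFinOrder t := by
      have := E.toMonoidHom.isOfFinOrder h2
      simpa [τ] using this
    have h4 := (SemidirectProduct.rightHom (φ := φ)).isOfFinOrder h3
    have h5 : (Multiplicative.ofAdd (1 : ℤ)) = 1 := (isOfFinOrder_iff_eq_one _).1 h4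
    have h6 : (1 : ℤ) = 0 := h5
    omega
  -- the commutator of `g` and `τ` lies in the image of `F`
  have hcomm : IsOfFinOrder (pV (g * τ * g⁻¹ * (τ : V)⁻¹)) := by
    let γ : H := ⟨g, hg⟩
    have h1 : (E (γ * τ * γ⁻¹ * τ⁻¹)).right = 1 := by
      simp only [map_mul, map_inv, SemidirectProduct.mul_right, SemidirectProduct.inv_right]
      rw [mul_comm (E γ).right, mul_inv_cancel_right, mul_inv_cancel]
    have h2 : IsOfFinOrder (E (γ * τ * γ⁻¹ * τ⁻¹)) := by
      rw [← SemidirectProduct.inl_left_mul_inr_right (E (γ * τ * γ⁻¹ * τ⁻¹)), h1, map_one, mul_one]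
      exact SemidirectProduct.inl.isOfFinOrder (isOfFinOrder_of_finite _)
    have h3 := E.symm.toMonoidHom.isOfFinOrder h2
    have h4 : IsOfFinOrder (γ * τ * γ⁻¹ * τ⁻¹) := by simpa using h3
    exact (pV.comp H.subtype).isOfFinOrder h4
  -- If `τ` lies over the rotation by `l`, the commutator is the rotation by `-2l`, and finite order
  -- forces `l = 0`. A reflection has order two. Both contradict `hτ`.
  rcases hτr : pV τ with l | l
  · rw [map_mul, map_mul, map_mul, map_inv, map_inv, hgr, hτr] at hcomm
    have h1 : (DihedralGroup.sr m * .r l * (.sr m)⁻¹ * (.r l)⁻¹ : DihedralGroup 0) =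
        .r (-l - l) := by
      rw [DihedralGroup.inv_sr, DihedralGroup.inv_r, DihedralGroup.sr_mul_r,
        DihedralGroup.sr_mul_sr, DihedralGroup.r_mul_r]
      congr 1
      ring
    rw [h1] at hcomm
    have h2 : (-l - l : ℤ) = 0 := dihedral_isOfFinOrder_r hcomm
    have h3 : l = 0 := by
      have h4 : ∀ a : ℤ, -a - a = 0 → a = 0 := by omega
      exact h4 l h2
    rw [hτr, h3] at hτ
    exact hτ (DihedralGroup.one_def (n := 0) ▸ IsOfFinOrder.one)
  · rw [hτr, isOfFinOrder_iff_pow_eq_one] at hτ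
    exact hτ ⟨2, by norm_num, by rw [sq]; exact DihedralGroup.sr_mul_self l⟩

/-- Restricting `pV` maps this kernel onto `pD.ker`, which is infinite cyclic, with finite kernel;
such an extension splits. -/
theorem ker_mem_finiteByCyclicFamily (hpV : Function.Surjective pV) [Finite pV.ker]
    (e : pD.ker ≃* Multiplicative ℤ) : (pD.comp pV).ker ∈ finiteByCyclicFamily V := by
  let q₀ : (pD.comp pV).ker →* pD.ker :=
    (pV.comp (pD.comp pV).ker.subtype).codRestrict _ fun g => g.2
  have hq₀ : Function.Surjective q₀ := by
    rintro ⟨d, hd⟩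
    obtain ⟨g, rfl⟩ := hpV d
    exact ⟨⟨g, hd⟩, rfl⟩
  let q := e.toMonoidHom.comp q₀
  have hq : Function.Surjective q := e.surjective.comp hq₀
  have hfin : Finite q.ker := by
    refine Finite.of_injective (β := pV.ker) (fun g => ⟨g.1.1, ?_⟩) fun g g' h => ?_
    · have h1 : e (q₀ g.1) = 1 := g.2
      rw [map_eq_one_iff e e.injective] at h1
      exact congrArg Subtype.val h1
    · exact Subtype.ext (Subtype.ext (congrArg (fun x : pV.ker => (x : V)) h))
  exact Or.inr (exists_mulEquiv_semidirectProduct hq)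

end Group

/-! ### The classifying space for the family of finite-by-cyclic subgroups -/

theorem theorem2p3
    -- the non-orientable virtually cyclic group `V`, with `1 → F → V → D_∞ → 1`, `F` finite
    {V : Type v} [Group V] (pV : V →* DihedralGroup 0)
    (hpV : Function.Surjective pV) (hF : Finite pV.ker)
    -- the extension `1 → ℤ → D_∞ → ℤ/2 → 1`
    (pD : DihedralGroup 0 →* Multiplicative (ZMod 2))
    (hpD : Function.Surjective pD) (hpD_ker : Nonempty (pD.ker ≃* Multiplicative ℤ))
    -- `A` is a model for `E_F V`
    {A : Type u} [TopologicalSpace A] [MulAction V A] [ContinuousConstSMul V A]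
    (sA : GCWStructure V A) (hA : IsClassifyingSpace V A (familyGeneratedBy pV.ker))
    -- `B` is a model for the classifying space of `V` for finite subgroups
    {B : Type u} [TopologicalSpace B] [MulAction V B] [ContinuousConstSMul V B]
    (sB : GCWStructure V B) (hB : IsClassifyingSpace V B (finiteFamily V))
    -- `C` is a model for `E(ℤ/2)`, on which `V` acts through `P_V = pD ∘ pV`
    {C : Type u} [TopologicalSpace C]
    [MulAction (Multiplicative (ZMod 2)) C] [ContinuousConstSMul (Multiplicative (ZMod 2)) C]
    (sC : GCWStructure (Multiplicative (ZMod 2)) C)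
    (hC : IsClassifyingSpace (Multiplicative (ZMod 2)) C
      (trivialFamily (Multiplicative (ZMod 2))))
    [MulAction V C] (hPV : ∀ (g : V) (c : C), g • c = (pD.comp pV) g • c)
    -- the inclusion `A → B` and a `V`-map `A → C`
    (i : A → B) (hi : IsGCWInclusion sA sB i)
    (f : A → C) (hf : Continuous f) (hf_smul : ∀ (g : V) a, f (g • a) = g • f a)
    -- the `V`-pushout `X`
    {X : Type u} [TopologicalSpace X] [MulAction V X] [ContinuousConstSMul V X]
    (j : B → X) (k : C → X) (hX : IsGPushout V i f j k) :
    -- `X` is a model as soon as the pushout is one of `V`-CW-complexes: if `f` is cellular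
    -- (the skeleta of `C` as a `V`-CW-complex are those of `C` as a `ℤ/2`-CW-complex), and
    -- also if `X` is a `V`-CW-complex for any other reason
    ((∀ n, Set.MapsTo f (sA.skeleton n) (sC.skeleton n)) →
      IsClassifyingSpace V X (finiteByCyclicFamily V)) ∧
    (Nonempty (GCWStructure V X) → IsClassifyingSpace V X (finiteByCyclicFamily V)) := by
  obtain ⟨e⟩ := hpD_ker
  have hcC : ContinuousConstSMul V C := ⟨fun g => by
    simp only [hPV g]
    exact continuous_const_smul _⟩
  have hP : Function.Surjective (pD.comp pV) := hpD.comp hpV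
  have hglue : IsGluing i f j k := hX.isGluing hi.isClosedEmbedding.injective hi.map_smul hf_smul
  -- the stabilizers of points of `C`
  have hstabC : ∀ (g : V) (c : C), g • c = c ↔ g ∈ (pD.comp pV).ker := fun g c => by
    have h1 : MulAction.stabilizer (Multiplicative (ZMod 2)) c = ⊥ := hC.stabilizer_mem c
    rw [hPV, ← MulAction.mem_stabilizer_iff, h1, Subgroup.mem_bot, MonoidHom.mem_ker]
  have hstab : ∀ x : X, MulAction.stabilizer V x ∈ finiteByCyclicFamily V := by
    have hright : ∀ c, MulAction.stabilizer V (k c) ∈ finiteByCyclicFamily V := fun c => by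
      convert ker_mem_finiteByCyclicFamily hpV e
      ext g
      rw [MulAction.mem_stabilizer_iff, ← hX.map_smul_right, hglue.injective_right.eq_iff, hstabC]
    intro x
    rcases hglue.surj x with ⟨b, rfl⟩ | ⟨c, rfl⟩
    · by_cases hb : b ∈ Set.range i
      · obtain ⟨a, rfl⟩ := hb
        rw [hglue.comm]
        exact hright _
      · have hfin : Finite (MulAction.stabilizer V b) := hB.stabilizer_mem b
        -- Outside `A`, gluing does not enlarge stabilizers.
        have hle : MulAction.stabilizer V (j b) ≤ MulAction.stabilizer V b := fun g hg => by
          have h1 : j (g • b) = j b := (hX.map_smul_left g b).trans hg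
          rcases hglue.left_eq_left _ _ h1 with h2 | h2
          · exact h2
          · exact (hb ((hi.smul_mem_range g).1 h2)).elim
        exact Or.inl (Finite.of_injective _ (Subgroup.inclusion_injective hle))
    · exact hright c
  have hfixC : ∀ H : Subgroup V, H ≤ (pD.comp pV).ker → MulAction.fixedPoints H C = Set.univ :=
    fun H hH => Set.eq_univ_of_forall fun c g => (hstabC g c).2 (hH g.2)
  have hCcontr : ∀ H : Subgroup V, H ≤ (pD.comp pV).ker →
      ContractibleSpace (MulAction.fixedPoints H C) := fun H hH => by
    have h1 := hC.contractible ⊥ rfl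
    have h2 : MulAction.fixedPoints (⊥ : Subgroup (Multiplicative (ZMod 2))) C = Set.univ := by
      refine Set.eq_univ_of_forall fun c g => ?_
      rw [Subsingleton.elim g 1, one_smul]
    exact (Homeomorph.setCongr ((hfixC H hH).trans h2.symm)).contractibleSpace
  have hcontr : ∀ H ∈ finiteByCyclicFamily V, ContractibleSpace (MulAction.fixedPoints H X) := by
    intro H hH
    have hfix := fun hcl => hglue.fixedPoints hi.isClosedEmbedding hf hi.map_smul hf_smul
      hX.map_smul_left hX.map_smul_right H (sB.isClosed_fixedPoints H) hcl
    by_cases hle : H ≤ (pD.comp pV).ker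
    · have hglueH := hfix (by rw [hfixC H hle]; exact isClosed_univ)
      have := hCcontr H hle
      by_cases hfin : Finite H
      · have := hB.contractible H hfin
        have := hA.contractible H ⟨1, by
          intro g hg
          exact ⟨g, finite_subgroup_le_ker e hle hg, by simp⟩⟩
        exact hglueH.contractibleSpace
          (continuous_fixedPointsMap hi.isClosedEmbedding.continuous _ H)
          (continuous_fixedPointsMap hf _ H) (hi.hasHEP_fixedPointsMap H)
      -- An infinite subgroup fixes no point of a space with finite stabilizers.
      · have : IsEmpty (MulAction.fixedPoints H B) := ⟨fun b => hfin (by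
          have : Finite (MulAction.stabilizer V (b : B)) := hB.stabilizer_mem b
          have hle : H ≤ MulAction.stabilizer V (b : B) := fun g hg => b.2 ⟨g, hg⟩
          exact Finite.of_injective _ (Subgroup.inclusion_injective hle))⟩
        exact hglueH.contractibleSpace_of_isEmpty_left
    · have hfin : Finite H := by
        rcases hH with h | ⟨F, _, _, φ, ⟨E⟩⟩
        · exact h
        · exact (hle (le_ker_of_mulEquiv_semidirectProduct e E)).elim
      have hempty : MulAction.fixedPoints H C = ∅ := Set.eq_empty_of_forall_notMem fun c hc =>
        hle fun g hg => (hstabC g c).1 (hc ⟨g, hg⟩)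
      have hglueH := hfix (by rw [hempty]; exact isClosed_empty)
      have : IsEmpty (MulAction.fixedPoints H C) := Set.isEmpty_coe_sort.2 hempty
      have := hB.contractible H hfin
      exact hglueH.contractibleSpace_of_isEmpty_right
  have hmain : Nonempty (GCWStructure V X) → IsClassifyingSpace V X (finiteByCyclicFamily V) :=
    fun h => ⟨h, hstab, hcontr⟩
  refine ⟨fun hcell => hmain ⟨?_⟩, hmain⟩
  exact hglue.gcwStructure (sC := sC.restrict hP hPV) hi hf
    (fun n => by
      rw [show (sC.restrict hP hPV).skeleton n = sC.skeleton n from sC.skeleton_restrictCells hP n]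
      exact hcell n)
    hX.map_smul_left hX.map_smul_right
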